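/- **Setting.** Let $n\ge 2$ and $d\ge 1$ be integers and $[n]=\{1,\dots,n\}$ a set of experts. In the partial information model, a prior $\mathcal D$ is a family of laws on $\mathbb R$, one for each $T\subseteq[n]$, of independent, mean-zero, square-integrable signals $X_T$, with $X_\emptyset=0$ almost surely and $\operatorname{Var}(X_T)>0$ for some $T$. Expert $i$ observes $\mathcal S_i=\{X_T: i\in T\}$, and the quantity to be estimated is $Y=\sum_T X_T$. A query $Q$ put to an expert $i=\mathsf{agent}(Q)$ is a real function of $\mathcal S_i$ and $\mathcal D$. It is elicitable with respect to a finite family $\mathcal R$ of random variables if there is a payment $\pi(r,\mathcal R)$, not depending on $\mathcal D$, such that under every prior $Q$ is almost surely the unique maximizer over $r\in\mathbb R$ of $\mathbb E_{\mathcal D}[\pi(r,\mathcal R)\mid\mathcal S_i]$. A directed acyclic graph $G$ on $\mathcal Q\cup\{Y\}$, for a finite list $\mathcal Q$ of queries, DAG-elicits $\mathcal Q$ if $Y$ is its unique sink and every $Q\in\mathcal Q$ is elicitable with respect to the set $N_G(Q)$ of its out-neighbours. The order complexity of $\mathcal Q$ is the minimum, over all $G$ that DAG-elicit $\mathcal Q$,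 of the maximum over $Q\in\mathcal Q$ of the length of a longest path from $Q$ to $Y$. The agent complexity is the minimum, over the same graphs, of the maximum over $Q\in\mathcal Q$ of the number of distinct experts $\mathsf{agent}(Q')$ with $Q'\in\mathcal Q$ reachable from $Q$ (including $Q'=Q$). A linear aggregation rule is a pair $(\mathcal Q,f)$ such that, for some $G$ that DAG-elicits $\mathcal Q$ and some constants $\alpha_{Q,Q'}$ (the same for all priors), each $Q\in\mathcal Q$ equals $\mathbb E_{\mathcal D}\big[\sum_{Q'\in N_G(Q)}\alpha_{Q,Q'}Q'\mid\mathcal S_{\mathsf{agent}(Q)}\big]$ almost surely under every prior, and $f(\mathcal Q)=\sum_{Q\in\mathcal Q}\beta_Q Q$ for some constants $\beta_Q$. A randomized linear aggregation rule draws a context $Z\sim P$, independent of the signals, and then uses a rule $(\mathcal Q_Z,f_Z)$ that is almost surely a linear aggregation rule; its output $f_Z(\mathcal Q_Z)$ is the approximator that it implements. Let $\mathcal A_d^{\mathrm{lin}}$ be the set of all approximators (real random variables, one under each prior) implemented by randomized linear aggregation rules for which $\mathcal Q_Z$ has order complexity and agent complexity at most $d$, almost surely. The worst-case error of an approximator $A$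 is $$\mathsf{error}(A)=\max_{\mathcal D}\frac{\mathbb E[(A-Y)^2]}{\operatorname{Var}_{\mathcal D}(Y)}\in[0,\infty],$$ the maximum being over all priors. **Proposition.** Let $n\ge2$, $d\ge1$ and $q(n)=\dfrac{\sqrt n+1}{\sqrt n-1}$. For every $A\in\mathcal A_d^{\mathrm{lin}}$ the maximum that defines $\mathsf{error}(A)$ is attained, and the minimum $\min_{A\in\mathcal A_d^{\mathrm{lin}}}\mathsf{error}(A)$ is attained. Moreover $$\min_{A\in\mathcal A_d^{\mathrm{lin}}}\mathsf{error}(A)=\frac{4}{\left(q(n)^d+q(n)^{-d}\right)^2}$$ if and only if $d=1$, or $d=2$ and $n$ is odd, or $d=3$ and $n\equiv1\pmod 4$. The equality also holds if and only if every point $x\in[1,n]$ at which $|\hat T_d|$ attains its maximum over $[1,n]$ is an integer, where $$\hat T_d(x)=\frac{T_d\!\left(\frac{2x-(n+1)}{n-1}\right)}{T_d\!\left(-\frac{n+1}{n-1}\right)}$$ and $T_d$ is the $d$-th Chebyshev polynomial of the first kind. -/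

import Mathlib

open MeasureTheory ProbabilityTheory

noncomputable section

namespace PartialInfo

/-- A realization of the signals: one real number `x T` for every set `T` of experts.
The experts are the elements of `Fin n`. -/
abbrev Signals (n : ℕ) : Type := Finset (Fin n) → ℝ

/-- A prior of the partial information model: the laws of the independent signals `X_T`. They are
centred and square-integrable, `X_∅ = 0` almost surely, and at least one has positive variance. -/
structure Prior (n : ℕ) where
  law : Finset (Fin n) → ProbabilityMeasure ℝ
  memLp : ∀ T, MemLp (fun x : ℝ => x) 2 (law T : Measure ℝ)
  mean_zero : ∀ T, ∫ x : ℝ, x ∂(law T : Measure ℝ) = 0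
  law_empty : (law ∅ : Measure ℝ) = Measure.dirac 0
  exists_variance_pos : ∃ T, 0 < variance (fun x : ℝ => x) (law T : Measure ℝ)

/-- The joint law of all signals (they are independent). -/
def Prior.joint {n : ℕ} (D : Prior n) : Measure (Signals n) :=
  Measure.pi fun T => (D.law T : Measure ℝ)

instance {n : ℕ} (D : Prior n) : IsProbabilityMeasure D.joint := by
  unfold Prior.joint; infer_instance

/-- The variable to be estimated: the sum of all signals. -/
def target {n : ℕ} (x : Signals n) : ℝ := ∑ T, x T

/-- The signals that expert `i` observes. -/
def observed {n : ℕ} (i : Fin n) (x : Signals n) : {T : Finset (Fin n) // i ∈ T} → ℝ :=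
  fun T => x T

/-- The σ-algebra generated by the signals that expert `i` observes. -/
abbrev info {n : ℕ} (i : Fin n) : MeasurableSpace (Signals n) :=
  MeasurableSpace.comap (observed i) inferInstance

/-- A query put to an expert: a real function of the prior and of what the expert observes. -/
structure Query (n : ℕ) where
  agent : Fin n
  answer : Prior n → ({T : Finset (Fin n) // agent ∈ T} → ℝ) → ℝ
  measurable_answer : ∀ D, Measurable (answer D)

/-- The answer to a query, as a random variable. -/
def Query.val {n : ℕ} (Q : Query n) (D : Prior n) (x : Signals n) : ℝ :=
  Q.answer D (observed Q.agent x)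

/-- `Q` is elicitable with respect to the random variables `R j`: for some payment `π`, not
depending on the prior, the answer to `Q` is almost surely the unique maximizer of the expert's
conditional expected payment. The conditional expectations given the expert's information are
integrals against the regular conditional distribution. -/
def Elicitable {n : ℕ} (Q : Query n) {J : Type} (R : Prior n → J → Signals n → ℝ) : Prop :=
  ∃ π : ℝ → (J → ℝ) → ℝ, (∀ r, Measurable (π r)) ∧
    ∀ D : Prior n, ∀ᵐ x ∂D.joint,
      (∀ r, Integrable (fun y => π r fun j => R D j y)
        (condExpKernel D.joint (info Q.agent) x)) ∧
      ∀ r, r ≠ Q.val D x →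
        ∫ y, π r (fun j => R D j y) ∂(condExpKernel D.joint (info Q.agent) x) <
          ∫ y, π (Q.val D x) (fun j => R D j y) ∂(condExpKernel D.joint (info Q.agent) x)

/-- The random variable at a vertex of an elicitation graph: vertex `some k` is the `k`-th query
and vertex `none` is the target `Y`. -/
def vertexVal {n m : ℕ} (Q : Fin m → Query n) (D : Prior n) : Option (Fin m) → Signals n → ℝ
  | none => target
  | some k => (Q k).val D

/-- `G` DAG-elicits the list of queries `Q`: it is acyclic, `Y` is its unique sink, and every
query is elicitable with respect to its out-neighbours. -/
structure DAGElicits {n m : ℕ} (G : Digraph (Option (Fin m))) (Q : Fin m → Query n) : Prop where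
  acyclic : ∀ v, ¬ Relation.TransGen G.Adj v v
  sink_iff : ∀ v, (∀ w, ¬ G.Adj v w) ↔ v = none
  elicitable : ∀ k, Elicitable (Q k)
    fun D (v : {v : Option (Fin m) // G.Adj (some k) v}) => vertexVal Q D v

/-- There is a directed walk of the given length between two vertices (in an acyclic graph, walks
are paths). -/
inductive HasWalk {V : Type} (G : Digraph V) : V → V → ℕ → Prop
  | nil (v : V) : HasWalk G v v 0
  | cons {u v w : V} {l : ℕ} (h : G.Adj u v) (p : HasWalk G v w l) : HasWalk G u w (l + 1)

/-- The order of the `k`-th query under `G`: the length of a longest path from it to `Y`. -/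
def order {m : ℕ} (G : Digraph (Option (Fin m))) (k : Fin m) : ℕ∞ :=
  ⨆ (l : ℕ) (_ : HasWalk G (some k) none l), (l : ℕ∞)

/-- The experts whose beliefs are relevant to the `k`-th query under `G`: those who answer a query
reachable from it (itself included). -/
def relevantAgents {n m : ℕ} (Q : Fin m → Query n) (G : Digraph (Option (Fin m)))
    (k : Fin m) : Set (Fin n) :=
  {i | ∃ j, Relation.ReflTransGen G.Adj (some k) (some j) ∧ (Q j).agent = i}

/-- Order complexity of a list of queries: least maximal order over all graphs that DAG-elicit
it (`⊤` if there is none). -/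
def orderComplexity {n m : ℕ} (Q : Fin m → Query n) : ℕ∞ :=
  ⨅ (G : Digraph (Option (Fin m))) (_ : DAGElicits G Q), ⨆ k, order G k

/-- Agent complexity of a list of queries: least maximal number of relevant experts over all
graphs that DAG-elicit it (`⊤` if there is none). -/
def agentComplexity {n m : ℕ} (Q : Fin m → Query n) : ℕ∞ :=
  ⨅ (G : Digraph (Option (Fin m))) (_ : DAGElicits G Q), ⨆ k, (relevantAgents Q G k).encard

/-- A deterministic aggregation rule: a finite list of queries and a function of the answers. -/
structure AggRule (n : ℕ) where
  size : ℕ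
  query : Fin size → Query n
  agg : (Fin size → ℝ) → ℝ

/-- The output of a deterministic aggregation rule. -/
def AggRule.output {n : ℕ} (R : AggRule n) (D : Prior n) (x : Signals n) : ℝ :=
  R.agg fun k => (R.query k).val D x

open Classical in
/-- Linear aggregation rules. For some graph that DAG-elicits the queries, every query is the
conditional expectation of a linear combination, with constant coefficients (the same for all
priors), of its out-neighbours; and the aggregation function is linear. -/
def AggRule.IsLinear {n : ℕ} (R : AggRule n) : Prop :=
  (∃ G : Digraph (Option (Fin R.size)), DAGElicits G R.query ∧
    ∃ α : Fin R.size → Option (Fin R.size) → ℝ, ∀ (D : Prior n) (k : Fin R.size),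
      (R.query k).val D =ᵐ[D.joint]
        D.joint[fun x => ∑ v with G.Adj (some k) v, α k v * vertexVal R.query D v x
          | info (R.query k).agent]) ∧
  ∃ β : Fin R.size → ℝ, ∀ a : Fin R.size → ℝ, R.agg a = ∑ k, β k * a k

/-- A (randomized) approximator: under each prior, a real random variable that depends on the
signals and on an independent random context `z` with law `P`. -/
structure Approximator (n : ℕ) where
  Context : Type
  [mContext : MeasurableSpace Context]
  P : Measure Context
  [isProbabilityMeasure : IsProbabilityMeasure P]
  val : Prior n → Context → Signals n → ℝ
  aemeasurable_val : ∀ D : Prior n,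
    AEMeasurable (fun p : Context × Signals n => val D p.1 p.2) (P.prod D.joint)

attribute [instance] Approximator.mContext Approximator.isProbabilityMeasure

/-- `A` is implemented by the randomized aggregation rule that draws `z` from `A.P` and then uses
the rule `R z`. -/
def Approximator.ImplementedBy {n : ℕ} (A : Approximator n) (R : A.Context → AggRule n) : Prop :=
  ∀ D : Prior n, ∀ᵐ p ∂(A.P.prod D.joint), A.val D p.1 p.2 = (R p.1).output D p.2

/-- The approximators implemented by randomized linear aggregation rules of agent and order
complexity at most `d`. The requirements on the rules in the support of the randomized rule are
requirements on almost every context. -/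
def linApproximators (n d : ℕ) : Set (Approximator n) :=
  {A | ∃ R : A.Context → AggRule n, A.ImplementedBy R ∧
    ∀ᵐ z ∂A.P, (R z).IsLinear ∧
      agentComplexity (R z).query ≤ d ∧ orderComplexity (R z).query ≤ d}

/-- The expected squared error of `A` under the prior `D`. -/
def Approximator.loss {n : ℕ} (A : Approximator n) (D : Prior n) : ENNReal :=
  ∫⁻ p, ENNReal.ofReal ((A.val D p.1 p.2 - target p.2) ^ 2) ∂(A.P.prod D.joint)

/-- The expected squared error of `A` under `D`, normalized by the variance of the target. -/
def Approximator.relLoss {n : ℕ} (A : Approximator n) (D : Prior n) : ENNReal :=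
  A.loss D / evariance target D.joint

/-- The worst-case error of `A` over all priors. -/
def Approximator.error {n : ℕ} (A : Approximator n) : ENNReal :=
  ⨆ D : Prior n, A.relLoss D

/-- `q(n) = (√n + 1) / (√n - 1)`. -/
def q (n : ℕ) : ℝ := (√(n : ℝ) + 1) / (√(n : ℝ) - 1)

/-- The affine map that carries `[1, n]` onto `[-1, 1]`. -/
def toUnit (n : ℕ) (x : ℝ) : ℝ := (2 * x - (n + 1)) / (n - 1)

/-- The Chebyshev polynomial of degree `d`, shifted to `[1, n]` and normalized to be `1` at `0`. -/
def shiftedChebyshev (n d : ℕ) (x : ℝ) : ℝ :=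
  (Polynomial.Chebyshev.T ℝ d).eval (toUnit n x) / (Polynomial.Chebyshev.T ℝ d).eval (toUnit n 0)

end PartialInfo

end

noncomputable section

namespace PartialInfo

/-! Conditioning a linear combination of the signals on the information of expert `i` keeps the
coefficients at the sets containing `i` and replaces the others by 0. Hence a deterministic linear
rule outputs `∑ f(T) X_T` with `f` independent of the prior. Its relative loss is the average of
`(f(T) - 1)^2` weighted by the variances of the signals, so its worst-case error is the maximum of
`(f(T) - 1)^2` over nonempty `T`. It remains to find which `f` occur and how close to 1 they come
uniformly.

The possible `f` form the span of the indicators of `S ⊆ T` with `1 ≤ |S| ≤ d` (`lowDegree`). The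
queries `supersetQuery` realize all of them. For the converse, the graph that attains the order
complexity may differ from the graph that carries the linear recursion, so the degree bound has to
come from elicitability alone. Under a prior of random signs, `a` and `-a` are atoms. If all
references vanish at `a`, one and the same payment function must be uniquely maximized by the answer
at `a` and by its negative, so the answer is 0 (`Elicitable.linComb_eq_zero`). By duality, a query
lies in the span of its truncated references, and induction along walks bounds the degree by the
order. Randomization does not help, by Jensen's inequality (`IsBestDistance.le_error`).

Averaging over the sets of each size `k` turns `1 - f` into a polynomial of degree at most `d` with
value 1 at 0, to be kept small on the integers `1, ..., n`. The shifted Chebyshev polynomial is a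
candidate. If its `d + 1` extremal points are integers, interpolation there proves it optimal
(`eval_le_mul_eval_T`). Otherwise at most `d` integers are extremal, and a perturbation that
vanishes at 0 improves it. For `d ≥ 4` the extremal points cannot all be integers, by Niven's
theorem. -/

/-! ### Chebyshev polynomials on the interval and on its integers -/

open Polynomial Polynomial.Chebyshev in
/-- A polynomial of degree at most `d` that is bounded by `c` at the Chebyshev nodes grows to the
right of `1` at most like `c * T_d`. -/
theorem eval_le_mul_eval_T {d : ℕ} {P : ℝ[X]} (hP : P.degree ≤ d) {c : ℝ}
    (hc : ∀ i ≤ d, |P.eval (node d i)| ≤ c) {x : ℝ} (hx : 1 ≤ x) :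
    P.eval x ≤ c * (T ℝ d).eval x := by
  have hlt : ∀ {R : ℝ[X]}, R.degree ≤ d → R.degree < (Finset.range (d + 1)).card := fun h =>
    lt_of_le_of_lt h (by rw [Finset.card_range]; exact_mod_cast Nat.lt_succ_self d)
  have hL : ∀ {R : ℝ[X]}, R.degree ≤ d → R.eval x = ∑ i ∈ Finset.range (d + 1),
      R.eval (node d i) * ((∏ j ∈ (Finset.range (d + 1)).erase i, (node d i - node d j))⁻¹ *
        ∏ j ∈ (Finset.range (d + 1)).erase i, (x - node d j)) := by
    intro R hR
    conv_lhs => rw [Lagrange.eq_interpolate (strictAntiOn_node d).injOn (hlt hR)]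
    rw [Lagrange.interpolate_apply, eval_finsetSum]
    refine Finset.sum_congr rfl fun i _ => ?_
    simp [Lagrange.basis, Lagrange.basisDivisor, eval_prod, Finset.prod_mul_distrib]
  rw [hL hP, hL (R := T ℝ d) (by simp), Finset.mul_sum]
  refine Finset.sum_le_sum fun i hi => ?_
  have hi' : i ≤ d := Finset.mem_range_succ_iff.1 hi
  rw [eval_T_real_node (Finset.mem_Iic.2 hi'), ← mul_assoc, ← mul_assoc, ← mul_assoc]
  refine mul_le_mul_of_nonneg_right ?_ (Finset.prod_nonneg fun j _ =>
    sub_nonneg.2 ((Real.cos_le_one _).trans hx))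
  -- The `i`-th Lagrange denominator has the sign `(-1)^i`, which is the value of `T_d` at the
  -- `i`-th node. So among polynomials bounded by `c` at the nodes, `c * T_d` maximizes every term
  -- at once.
  have hpos := inv_pos.2 (zero_lt_prod_node_sub_node hi')
  rw [mul_inv, ← inv_pow, inv_neg_one] at hpos
  have h1 : P.eval (node d i) * (-1) ^ i ≤ c := by
    refine (le_abs_self _).trans ?_
    rw [abs_mul, abs_neg_one_pow, mul_one]
    exact hc i hi'
  have h2 := mul_le_mul_of_nonneg_right h1 hpos.le
  have h3 : ((-1 : ℝ) ^ i) * (-1) ^ i = 1 := by rw [← mul_pow]; simp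
  calc _ = P.eval (node d i) * ((-1) ^ i * (-1) ^ i) *
        (∏ j ∈ (Finset.range (d + 1)).erase i, (node d i - node d j))⁻¹ := by rw [h3, mul_one]
    _ ≤ _ := by nlinarith [h2]

/-- The extremal points of the Chebyshev polynomial of degree `d`, carried to `[1, n]`. -/
def gridPoint (n d i : ℕ) : ℝ := ((n + 1) - (n - 1) * Polynomial.Chebyshev.node d i) / 2

/-- The maximum over `[1, n]` of the shifted Chebyshev polynomial. -/
def chebyshevBound (n d : ℕ) : ℝ :=
  1 / (Polynomial.Chebyshev.T ℝ d).eval (((n : ℝ) + 1) / (n - 1))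

theorem one_lt_ratio {n : ℕ} (hn : 2 ≤ n) : 1 < ((n : ℝ) + 1) / (n - 1) := by
  have : (2 : ℝ) ≤ n := by exact_mod_cast hn
  rw [lt_div_iff₀ (by linarith)]; linarith

theorem chebyshevBound_pos {n : ℕ} (hn : 2 ≤ n) (d : ℕ) : 0 < chebyshevBound n d :=
  one_div_pos.2 (zero_lt_one.trans_le
    (Polynomial.Chebyshev.one_le_eval_T_real d (one_lt_ratio hn).le))

/-- Since `q + 1/q = 2(n+1)/(n-1)`, the point of evaluation is `cosh (log q)`, and `T_d (cosh θ) =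
cosh (d θ)`. -/
theorem chebyshevBound_eq {n : ℕ} (hn : 2 ≤ n) (d : ℕ) :
    chebyshevBound n d = 2 / (q n ^ (d : ℤ) + q n ^ (-(d : ℤ))) := by
  have h2 : (2 : ℝ) ≤ n := by exact_mod_cast hn
  have hs : 1 < √(n : ℝ) := by rw [Real.lt_sqrt] <;> linarith
  have hq : 0 < q n := div_pos (by linarith) (by linarith)
  have hsq : √(n : ℝ) ^ 2 = n := Real.sq_sqrt (by linarith)
  have hc : ((n : ℝ) + 1) / (n - 1) = Real.cosh (Real.log (q n)) := by
    rw [Real.cosh_eq, Real.exp_neg, Real.exp_log hq, q]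
    have h3 : √(n : ℝ) - 1 ≠ 0 := by linarith
    have h4 : √(n : ℝ) + 1 ≠ 0 := by linarith
    have h5 : (n : ℝ) - 1 = (√(n : ℝ) - 1) * (√(n : ℝ) + 1) := by linear_combination -hsq
    rw [h5]
    field_simp
    nlinarith
  have he : ∀ k : ℤ, Real.exp (k * Real.log (q n)) = q n ^ k := by
    intro k
    rw [mul_comm, ← Real.rpow_def_of_pos hq, Real.rpow_intCast]
  rw [chebyshevBound, hc, Polynomial.Chebyshev.T_real_cosh, Real.cosh_eq, he,
    show -(((d : ℤ) : ℝ) * Real.log (q n)) = ((-(d : ℤ) : ℤ) : ℝ) * Real.log (q n) by push_cast; ring,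
    he, one_div_div]

open Polynomial Polynomial.Chebyshev in
/-- If the extremal points are integers, then a polynomial of degree at most `d` with value `1`
at `0` is not smaller on the integers of `[1, n]` than the shifted Chebyshev polynomial. -/
theorem chebyshevBound_le_of_forall_abs_le {n d : ℕ} (hn : 2 ≤ n)
    (hE : ∀ i ≤ d, ∃ k : ℤ, gridPoint n d i = k) {p : ℝ[X]} (hp : p.degree ≤ d)
    (hp0 : p.eval 0 = 1) {c : ℝ} (hc : ∀ k : ℕ, 1 ≤ k → k ≤ n → |p.eval (k : ℝ)| ≤ c) :
    chebyshevBound n d ≤ c := by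
  have h2 : (2 : ℝ) ≤ n := by exact_mod_cast hn
  have hn1 : (n : ℝ) - 1 ≠ 0 := by linarith
  -- The substitution reverses orientation, so that 0 corresponds to `(n+1)/(n-1)`, to the right of
  -- 1, where the growth bound applies.
  set P : ℝ[X] := p.comp (C (((n : ℝ) + 1) / 2) - C (((n : ℝ) - 1) / 2) * X) with hPdef
  have hev : ∀ y, P.eval y = p.eval (((n + 1) - (n - 1) * y) / 2) := by
    intro y; simp only [hPdef, eval_comp, eval_sub, eval_mul, eval_C, eval_X]; congr 1; ring
  have hdeg : P.degree ≤ d := by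
    refine natDegree_le_iff_degree_le.1 (natDegree_comp_le.trans ?_)
    have h1 : (C (((n : ℝ) + 1) / 2) - C (((n : ℝ) - 1) / 2) * X).natDegree ≤ 1 := by
      compute_degree
    calc _ ≤ d * 1 := Nat.mul_le_mul (natDegree_le_iff_degree_le.2 hp) h1
      _ = d := mul_one d
  have hb : ∀ i ≤ d, |P.eval (node d i)| ≤ c := by
    intro i hi
    obtain ⟨k, hk⟩ := hE i hi
    have hm := node_mem_Icc (n := d) (i := i)
    have hk1 : (1 : ℝ) ≤ k := by rw [← hk, gridPoint]; nlinarith [hm.2]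
    have hkn : (k : ℝ) ≤ n := by rw [← hk, gridPoint]; nlinarith [hm.1]
    have hk1' : 1 ≤ k := by exact_mod_cast hk1
    lift k to ℕ using by omega
    rw [hev, show ((n + 1 : ℝ) - (n - 1) * node d i) / 2 = (k : ℝ) from by
      simpa [gridPoint] using hk]
    exact hc k (by exact_mod_cast hk1') (by exact_mod_cast hkn)
  have h := eval_le_mul_eval_T hdeg hb (one_lt_ratio hn).le
  rw [hev, show ((n + 1 : ℝ) - (n - 1) * ((n + 1) / (n - 1))) / 2 = 0 from by field_simp; ring,
    hp0] at h
  rw [chebyshevBound, div_le_iff₀ (zero_lt_one.trans_le (one_le_eval_T_real d (one_lt_ratio hn).le))]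
  exact h

open Polynomial Polynomial.Chebyshev in
/-- The shifted Chebyshev polynomial, as a polynomial. -/
def chebyshevPoly (n d : ℕ) : ℝ[X] :=
  C (chebyshevBound n d) *
    (T ℝ d).comp (C (((n : ℝ) + 1) / (n - 1)) - C (2 / ((n : ℝ) - 1)) * X)

open Polynomial Polynomial.Chebyshev in
theorem chebyshevPoly_degree_le (n d : ℕ) : (chebyshevPoly n d).degree ≤ d := by
  refine natDegree_le_iff_degree_le.1 ?_
  have h1 : (C (((n : ℝ) + 1) / (n - 1)) - C (2 / ((n : ℝ) - 1)) * X).natDegree ≤ 1 := by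
    compute_degree
  calc _ ≤ _ := natDegree_C_mul_le _ _
    _ ≤ _ := natDegree_comp_le
    _ ≤ d * 1 := Nat.mul_le_mul (by simp) h1
    _ = d := mul_one d

open Polynomial Polynomial.Chebyshev in
theorem chebyshevPoly_eval (n d : ℕ) (x : ℝ) : (chebyshevPoly n d).eval x =
    chebyshevBound n d * (T ℝ d).eval (((n + 1) - 2 * x) / (n - 1)) := by
  simp only [chebyshevPoly, eval_mul, eval_comp, eval_sub, eval_C, eval_X]
  congr 2; ring

theorem chebyshevPoly_eval_zero {n : ℕ} (hn : 2 ≤ n) (d : ℕ) : (chebyshevPoly n d).eval 0 = 1 := by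
  have h := Polynomial.Chebyshev.one_le_eval_T_real d (one_lt_ratio hn).le
  rw [chebyshevPoly_eval, mul_zero, sub_zero, chebyshevBound, one_div_mul_cancel]
  linarith

theorem abs_shift_le_one {n : ℕ} (hn : 2 ≤ n) {x : ℝ} (hx : x ∈ Set.Icc (1 : ℝ) n) :
    |((n + 1) - 2 * x) / (n - 1)| ≤ 1 := by
  have h2 : (2 : ℝ) ≤ n := by exact_mod_cast hn
  rw [abs_le, le_div_iff₀ (by linarith), div_le_iff₀ (by linarith)]
  constructor <;> linarith [hx.1, hx.2]

theorem abs_chebyshevPoly_eval_le {n : ℕ} (hn : 2 ≤ n) (d : ℕ) {x : ℝ}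
    (hx : x ∈ Set.Icc (1 : ℝ) n) : |(chebyshevPoly n d).eval x| ≤ chebyshevBound n d := by
  rw [chebyshevPoly_eval, abs_mul, abs_of_pos (chebyshevBound_pos hn d)]
  exact mul_le_of_le_one_right (chebyshevBound_pos hn d).le
    (Polynomial.Chebyshev.abs_eval_T_real_le_one d (abs_shift_le_one hn hx))

/-- On the whole real line `|T_d| = 1` only at the points `cos (iπ/d)`, so `x` need not be confined
to `[1, n]`. The constant `T_0` has to be excluded. -/
theorem abs_chebyshevPoly_eval_eq_iff {n d : ℕ} (hn : 2 ≤ n) (hd : d ≠ 0) (x : ℝ) :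
    |(chebyshevPoly n d).eval x| = chebyshevBound n d ↔ ∃ i ≤ d, x = gridPoint n d i := by
  have h2 : (2 : ℝ) ≤ n := by exact_mod_cast hn
  have hn1 : (n : ℝ) - 1 ≠ 0 := by linarith
  rw [chebyshevPoly_eval, abs_mul, abs_of_pos (chebyshevBound_pos hn d),
    mul_eq_left₀ (chebyshevBound_pos hn d).ne',
    Polynomial.Chebyshev.abs_eval_T_real_eq_one_iff hd]
  refine exists_congr fun i => and_congr_right fun _ => ?_
  rw [gridPoint, Polynomial.Chebyshev.node, div_eq_iff hn1, eq_div_iff two_ne_zero]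
  constructor <;> intro h <;> linarith

open Polynomial in
/-- If some extremal point is not an integer, then the shifted Chebyshev polynomial can be improved
on the integers. -/
theorem exists_forall_abs_lt_chebyshevBound {n d : ℕ} (hn : 2 ≤ n) (hd : d ≠ 0)
    (hE : ¬ ∀ i ≤ d, ∃ k : ℤ, gridPoint n d i = k) :
    ∃ p : ℝ[X], p.degree ≤ d ∧ p.eval 0 = 1 ∧
      ∀ k : ℕ, 1 ≤ k → k ≤ n → |p.eval (k : ℝ)| < chebyshevBound n d := by
  classical
  push Not at hE
  obtain ⟨i₀, hi₀, hne⟩ := hE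
  set M := chebyshevBound n d
  have hM : 0 < M := chebyshevBound_pos hn d
  set t := chebyshevPoly n d
  set E : Finset ℕ := {k ∈ Finset.Icc 1 n | |t.eval (k : ℝ)| = M} with hEdef
  -- There are at most `d + 1` grid points, and the one with index `i₀` is not an integer. This
  -- leaves room for 0 as an additional interpolation node in degree `d`.
  have hcard : E.card ≤ d := by
    have hsub : E.image (fun k : ℕ => (k : ℝ)) ⊆
        ((Finset.range (d + 1)).erase i₀).image (gridPoint n d) := by
      intro x hx
      obtain ⟨k, hk, rfl⟩ := Finset.mem_image.1 hx
      obtain ⟨i, hi, hki⟩ :=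
        (abs_chebyshevPoly_eval_eq_iff hn hd _).1 (Finset.mem_filter.1 hk).2
      refine Finset.mem_image.2 ⟨i, Finset.mem_erase.2 ⟨?_, Finset.mem_range_succ_iff.2 hi⟩,
        hki.symm⟩
      rintro rfl
      exact hne k (by rw [← hki]; simp)
    have h1 := Finset.card_le_card hsub
    rw [Finset.card_image_of_injective _ Nat.cast_injective] at h1
    refine h1.trans (Finset.card_image_le.trans ?_)
    rw [Finset.card_erase_of_mem (Finset.mem_range_succ_iff.2 hi₀), Finset.card_range]
    omega
  have h0E : (0 : ℕ) ∉ E := by simp [hEdef]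
  have hinj : Set.InjOn (fun k : ℕ => (k : ℝ)) (insert 0 E : Finset ℕ) :=
    Nat.cast_injective.injOn
  -- The direction of descent: value 0 at 0 preserves the normalization, and `-t` on `E` shrinks `t`
  -- there by the factor `1 - ε`. Off `E` the strict inequality survives for small `ε`.
  set val : ℕ → ℝ := fun k => if k = 0 then 0 else -t.eval (k : ℝ) with hval
  set r : ℝ[X] := Lagrange.interpolate (insert 0 E) (fun k : ℕ => (k : ℝ)) val with hr
  have hrd : r.degree ≤ d := by
    have h := Lagrange.degree_interpolate_le val hinj
    rw [Finset.card_insert_of_notMem h0E, Nat.add_sub_cancel] at h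
    exact h.trans (by exact_mod_cast hcard)
  have hr0 : r.eval 0 = 0 := by
    have h : r.eval ((0 : ℕ) : ℝ) = val 0 :=
      Lagrange.eval_interpolate_at_node val hinj (Finset.mem_insert_self 0 E)
    rw [← Nat.cast_zero, h]
    simp [hval]
  have hrE : ∀ k ∈ E, r.eval (k : ℝ) = -t.eval (k : ℝ) := by
    intro k hk
    have h : r.eval (k : ℝ) = val k :=
      Lagrange.eval_interpolate_at_node val hinj (Finset.mem_insert_of_mem hk)
    have hk0 : k ≠ 0 := fun h => h0E (h ▸ hk)
    simp [h, hval, hk0]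
  have hev : ∀ k ∈ Finset.Icc 1 n, ∀ᶠ ε : ℝ in nhdsWithin 0 (Set.Ioi 0),
      |t.eval (k : ℝ) + ε * r.eval (k : ℝ)| < M := by
    intro k hk
    obtain ⟨hk1, hkn⟩ := Finset.mem_Icc.1 hk
    by_cases hkE : k ∈ E
    · filter_upwards [Ioo_mem_nhdsGT (zero_lt_one' ℝ)] with ε hε
      rw [hrE k hkE, show t.eval (k : ℝ) + ε * -t.eval (k : ℝ) = (1 - ε) * t.eval (k : ℝ) by ring,
        abs_mul, (Finset.mem_filter.1 hkE).2, abs_of_pos (by linarith [hε.2])]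
      nlinarith [hε.1]
    · have hlt : |t.eval (k : ℝ)| < M := by
        refine lt_of_le_of_ne (abs_chebyshevPoly_eval_le hn d
          ⟨by exact_mod_cast hk1, by exact_mod_cast hkn⟩) fun h => hkE ?_
        exact Finset.mem_filter.2 ⟨hk, h⟩
      have hcont : Continuous fun ε : ℝ => |t.eval (k : ℝ) + ε * r.eval (k : ℝ)| := by fun_prop
      exact nhdsWithin_le_nhds
        (hcont.continuousAt.eventually_lt continuousAt_const (by simpa using hlt))
  obtain ⟨ε, hε⟩ := ((Filter.eventually_all_finset _).2 hev).exists
  refine ⟨t + C ε * r, ?_, ?_, ?_⟩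
  · refine (degree_add_le _ _).trans (max_le (chebyshevPoly_degree_le n d) ?_)
    exact natDegree_le_iff_degree_le.1
      ((natDegree_C_mul_le _ _).trans (natDegree_le_iff_degree_le.2 hrd))
  · simp [t, chebyshevPoly_eval_zero hn, hr0]
  · intro k hk1 hkn
    simpa using hε k (Finset.mem_Icc.2 ⟨hk1, hkn⟩)

/-! ### Integrality of the extremal points -/

/-- The extremal points of the shifted Chebyshev polynomial are the grid points. -/
theorem forall_isMaxOn_isInt_iff {n d : ℕ} (hn : 2 ≤ n) (hd : d ≠ 0) :
    (∀ x ∈ Set.Icc (1 : ℝ) n,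
      IsMaxOn (fun y => |shiftedChebyshev n d y|) (Set.Icc (1 : ℝ) n) x → ∃ k : ℤ, x = k) ↔
    ∀ i ≤ d, ∃ k : ℤ, gridPoint n d i = k := by
  have h2 : (2 : ℝ) ≤ n := by exact_mod_cast hn
  have habs : ∀ y, |shiftedChebyshev n d y| = |(chebyshevPoly n d).eval y| := by
    intro y
    have hneg : ∀ z : ℝ, |(Polynomial.Chebyshev.T ℝ d).eval (-z)| =
        |(Polynomial.Chebyshev.T ℝ d).eval z| := by
      intro z; rw [Polynomial.Chebyshev.T_eval_neg, abs_mul, abs_unit_intCast,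
        one_mul]
    rw [shiftedChebyshev, chebyshevPoly_eval, abs_div, abs_mul, chebyshevBound, abs_div, abs_one,
      toUnit, toUnit, show (2 * y - (n + 1)) / ((n : ℝ) - 1) = -(((n + 1) - 2 * y) / (n - 1)) by ring,
      show (2 * 0 - (n + 1)) / ((n : ℝ) - 1) = -((n + 1) / (n - 1)) by ring, hneg, hneg]
    ring
  have hmem : ∀ i, gridPoint n d i ∈ Set.Icc (1 : ℝ) n := by
    intro i
    have hm := Polynomial.Chebyshev.node_mem_Icc (n := d) (i := i)
    constructor <;> rw [gridPoint] <;> nlinarith [hm.1, hm.2]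
  have hmax : ∀ x ∈ Set.Icc (1 : ℝ) n,
      IsMaxOn (fun y => |shiftedChebyshev n d y|) (Set.Icc (1 : ℝ) n) x ↔
        ∃ i ≤ d, x = gridPoint n d i := by
    intro x hx
    rw [← abs_chebyshevPoly_eval_eq_iff hn hd]
    simp only [isMaxOn_iff, habs]
    constructor
    · intro h
      refine le_antisymm (abs_chebyshevPoly_eval_le hn d hx) ?_
      have h0 := (abs_chebyshevPoly_eval_eq_iff hn hd (gridPoint n d 0)).2 ⟨0, d.zero_le, rfl⟩
      exact h0 ▸ h _ (hmem 0)
    · intro h y hy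
      rw [h]
      exact abs_chebyshevPoly_eval_le hn d hy
  constructor
  · intro h i hi
    exact h _ (hmem i) ((hmax _ (hmem i)).2 ⟨i, hi, rfl⟩)
  · intro h x hx hm
    obtain ⟨i, hi, rfl⟩ := (hmax x hx).1 hm
    exact h i hi

/-- The extremal points are integers in exactly three families of cases. -/
theorem forall_gridPoint_isInt_iff {n d : ℕ} (hn : 2 ≤ n) (hd : 1 ≤ d) :
    (∀ i ≤ d, ∃ k : ℤ, gridPoint n d i = k) ↔
      d = 1 ∨ (d = 2 ∧ Odd n) ∨ (d = 3 ∧ n ≡ 1 [MOD 4]) := by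
  have h2 : (2 : ℝ) ≤ n := by exact_mod_cast hn
  have hd0 : (d : ℝ) ≠ 0 := by positivity
  have hfirst : gridPoint n d 0 = 1 := by
    rw [gridPoint, Polynomial.Chebyshev.node_eq_one]; ring
  have hlast : gridPoint n d d = n := by
    rw [gridPoint, Polynomial.Chebyshev.node_eq_neg_one (by omega)]; ring
  constructor
  · intro h
    rcases (by omega : d = 1 ∨ d = 2 ∨ d = 3 ∨ 4 ≤ d) with rfl | rfl | rfl | h4
    · exact Or.inl rfl
    · refine Or.inr (Or.inl ⟨rfl, ?_⟩)
      obtain ⟨k, hk⟩ := h 1 (by norm_num)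
      have hc : Polynomial.Chebyshev.node 2 1 = 0 := by
        rw [Polynomial.Chebyshev.node]; norm_num
      rw [gridPoint, hc] at hk
      have : (n : ℤ) + 1 = 2 * k := by
        have : (n : ℝ) + 1 = 2 * k := by linarith
        exact_mod_cast this
      rw [Nat.odd_iff]; omega
    · refine Or.inr (Or.inr ⟨rfl, ?_⟩)
      obtain ⟨k, hk⟩ := h 1 (by norm_num)
      have hc : Polynomial.Chebyshev.node 3 1 = 1 / 2 := by
        rw [Polynomial.Chebyshev.node, ← Real.cos_pi_div_three]; norm_num
      rw [gridPoint, hc] at hk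
      have : (n : ℤ) + 3 = 4 * k := by
        have : (n : ℝ) + 3 = 4 * k := by linarith
        exact_mod_cast this
      rw [Nat.ModEq]; omega
    · exfalso
      obtain ⟨k, hk⟩ := h 1 hd
      -- Niven's theorem: `cos (π/d)` is irrational once `d > 3`, whereas an integral grid point of
      -- index 1 would make it rational.
      have hirr : Irrational (Real.cos (((1 / d : ℚ) : ℝ) * Real.pi)) := by
        apply irrational_cos_rat_mul_pi
        rw [one_div, Rat.inv_natCast_den]
        split_ifs <;> omega
      refine hirr ⟨((n + 1) - 2 * k) / (n - 1), ?_⟩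
      rw [gridPoint, Polynomial.Chebyshev.node] at hk
      push_cast
      rw [div_eq_iff (by linarith), show 1 / (d : ℝ) * Real.pi = 1 * Real.pi / d by ring]
      push_cast at hk
      linarith
  · rintro (rfl | ⟨rfl, ⟨m, hm⟩⟩ | ⟨rfl, hm⟩) i hi
    · interval_cases i
      · exact ⟨1, by rw [hfirst]; simp⟩
      · exact ⟨n, by rw [hlast]; simp⟩
    · interval_cases i
      · exact ⟨1, by rw [hfirst]; simp⟩
      · refine ⟨m + 1, ?_⟩
        have hc : Polynomial.Chebyshev.node 2 1 = 0 := by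
          rw [Polynomial.Chebyshev.node]; norm_num
        rw [gridPoint, hc, hm]; push_cast; ring
      · exact ⟨n, by rw [hlast]; simp⟩
    · obtain ⟨m, rfl⟩ : ∃ m, n = 4 * m + 1 := ⟨n / 4, by rw [Nat.ModEq] at hm; omega⟩
      have hc : Polynomial.Chebyshev.node 3 1 = 1 / 2 := by
        rw [Polynomial.Chebyshev.node, ← Real.cos_pi_div_three]; norm_num
      have hc' : Polynomial.Chebyshev.node 3 2 = -(1 / 2) := by
        rw [Polynomial.Chebyshev.node, ← Real.cos_pi_div_three, ← Real.cos_pi_sub]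
        congr 1; push_cast; ring
      interval_cases i
      · exact ⟨1, by rw [hfirst]; simp⟩
      · refine ⟨m + 1, ?_⟩
        rw [gridPoint, hc]; push_cast; ring
      · refine ⟨3 * m + 1, ?_⟩
        rw [gridPoint, hc']; push_cast; ring
      · exact ⟨(4 * m + 1 : ℕ), by rw [hlast]; simp⟩

/-! ### Functions of low degree on sets of experts -/

/-- The indicator of the sets that contain `S`. -/
def containing {n : ℕ} (S T : Finset (Fin n)) : ℝ := if S ⊆ T then 1 else 0

/-- The functions of a set of experts of degree at most `d`, as polynomials in the indicators of
membership, without constant term. -/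
def lowDegree (n d : ℕ) : Submodule ℝ (Finset (Fin n) → ℝ) :=
  Submodule.span ℝ (containing '' {S | S.Nonempty ∧ S.card ≤ d})

theorem containing_mem_lowDegree {n d : ℕ} {S : Finset (Fin n)} (hS : S.Nonempty)
    (hd : S.card ≤ d) : containing S ∈ lowDegree n d :=
  Submodule.subset_span ⟨S, ⟨hS, hd⟩, rfl⟩

theorem lowDegree_mono {n d e : ℕ} (h : d ≤ e) : lowDegree n d ≤ lowDegree n e :=
  Submodule.span_mono (Set.image_mono fun _ hS => ⟨hS.1, hS.2.trans h⟩)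

/-- Every spanning indicator belongs to a nonempty `S`. This pins down the coefficient at `∅`, which
the loss cannot detect because `X_∅ = 0`. -/
theorem lowDegree_apply_empty {n d : ℕ} {f : Finset (Fin n) → ℝ} (hf : f ∈ lowDegree n d) :
    f ∅ = 0 := by
  refine Submodule.span_induction (p := fun f _ => f ∅ = 0) ?_ rfl ?_ ?_ hf
  · rintro _ ⟨S, hS, rfl⟩
    simp [containing, Finset.subset_empty, hS.1.ne_empty]
  · intro f g _ _ hf hg; simp [hf, hg]
  · intro a f _ hf; simp [hf]

/-- Multiplying the indicator of `S ⊆ T` by that of `i ∈ T` gives the indicator of `insert i S ⊆ T`.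
This truncation is the effect of conditioning on expert `i`, so each conditioning costs one degree.
-/
theorem mem_mul_mem_lowDegree {n d : ℕ} (i : Fin n) {f : Finset (Fin n) → ℝ}
    (hf : f ∈ lowDegree n d) : (fun T => if i ∈ T then f T else 0) ∈ lowDegree n (d + 1) := by
  refine Submodule.span_induction
    (p := fun f _ => (fun T => if i ∈ T then f T else 0) ∈ lowDegree n (d + 1)) ?_ ?_ ?_ ?_ hf
  · rintro _ ⟨S, hS, rfl⟩
    convert containing_mem_lowDegree (d := d + 1) (S := insert i S) (Finset.insert_nonempty _ _)
      ((Finset.card_insert_le _ _).trans (Nat.succ_le_succ hS.2)) using 1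
    funext T
    simp only [containing, Finset.insert_subset_iff, ite_and]
  · convert (lowDegree n (d + 1)).zero_mem using 1
    funext T; simp
  · intro f g _ _ hf hg
    convert (lowDegree n (d + 1)).add_mem hf hg using 1
    funext T; by_cases h : i ∈ T <;> simp [h]
  · intro a f _ hf
    convert (lowDegree n (d + 1)).smul_mem a hf using 1
    funext T; by_cases h : i ∈ T <;> simp [h]

/-- `|T|` is the sum of the indicators of `i ∈ T`, so each further power costs one degree. The
exponent starts at 1 because constants are not in the space. -/
theorem card_pow_mem_lowDegree (n j : ℕ) :
    (fun T : Finset (Fin n) => (T.card : ℝ) ^ (j + 1)) ∈ lowDegree n (j + 1) := by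
  have hcard : ∀ (T : Finset (Fin n)) (a : ℝ), (T.card : ℝ) * a = ∑ i, if i ∈ T then a else 0 := by
    intro T a; simp
  induction j with
  | zero =>
    convert (lowDegree n 1).sum_mem (t := Finset.univ)
      (fun i _ => containing_mem_lowDegree (d := 1) (Finset.singleton_nonempty i) (by simp)) using 1
    funext T
    simp [containing, Finset.singleton_subset_iff]
  | succ j ih =>
    convert (lowDegree n (j + 2)).sum_mem (t := Finset.univ)
      (fun i _ => mem_mul_mem_lowDegree i ih) using 1
    funext T
    rw [pow_succ', hcard, Finset.sum_apply]

/-- A polynomial in the number of elements has low degree. -/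
theorem eval_card_mem_lowDegree {n d : ℕ} {p : Polynomial ℝ} (hp : p.degree ≤ d)
    (hp0 : p.eval 0 = 0) : (fun T : Finset (Fin n) => p.eval (T.card : ℝ)) ∈ lowDegree n d := by
  have hpd : p.natDegree < d + 1 := Nat.lt_succ_of_le (Polynomial.natDegree_le_iff_degree_le.2 hp)
  have h0 : p.coeff 0 = 0 := by rw [Polynomial.coeff_zero_eq_eval_zero, hp0]
  convert (lowDegree n d).sum_mem (t := Finset.range d)
    (f := fun j => p.coeff (j + 1) • fun T : Finset (Fin n) => (T.card : ℝ) ^ (j + 1))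
    (fun j hj => (lowDegree n d).smul_mem _ (lowDegree_mono (Nat.succ_le_of_lt
      (Finset.mem_range.1 hj)) (card_pow_mem_lowDegree n j))) using 1
  funext T
  rw [Polynomial.eval_eq_sum_range' hpd, Finset.sum_range_succ', h0]
  simp

theorem card_powersetCard_filter_subset {n : ℕ} (S : Finset (Fin n)) {k : ℕ} (hk : S.card ≤ k) :
    ((Finset.powersetCard k Finset.univ).filter (S ⊆ ·)).card =
      (n - S.card).choose (k - S.card) := by
  have hc : (n - S.card) = Sᶜ.card := by rw [Finset.card_compl, Fintype.card_fin]
  rw [hc, ← Finset.card_powersetCard]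
  refine Finset.card_nbij' (fun T => T \ S) (fun T => T ∪ S) ?_ ?_ ?_ ?_
  · intro T hT
    simp only [Finset.coe_filter, Finset.mem_powersetCard, Set.mem_ofPred_eq] at hT
    simp only [Finset.mem_coe, Finset.mem_powersetCard]
    refine ⟨fun x hx => ?_, by rw [Finset.card_sdiff_of_subset hT.2, hT.1.2]⟩
    simp only [Finset.mem_sdiff] at hx
    simpa using hx.2
  · intro T hT
    simp only [Finset.mem_coe, Finset.mem_powersetCard] at hT
    have hdis : Disjoint T S := by
      rw [Finset.disjoint_left]; intro x hx; simpa using hT.1 hx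
    simp only [Finset.coe_filter, Finset.mem_powersetCard, Set.mem_ofPred_eq]
    refine ⟨⟨Finset.subset_univ _, ?_⟩, Finset.subset_union_right⟩
    rw [Finset.card_union_of_disjoint hdis, hT.2]; omega
  · intro T hT
    simp only [Finset.coe_filter, Finset.mem_powersetCard, Set.mem_ofPred_eq] at hT
    exact Finset.sdiff_union_of_subset hT.2
  · intro T hT
    simp only [Finset.mem_coe, Finset.mem_powersetCard] at hT
    have hdis : Disjoint T S := by
      rw [Finset.disjoint_left]; intro x hx; simpa using hT.1 hx
    exact Finset.union_sdiff_cancel_right hdis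

/-- The averages of a function of low degree over the sets of each size are given by a
polynomial. -/
theorem exists_polynomial_sum_powersetCard {n d : ℕ} {f : Finset (Fin n) → ℝ}
    (hf : f ∈ lowDegree n d) : ∃ p : Polynomial ℝ, p.degree ≤ d ∧ p.eval 0 = 0 ∧
      ∀ k ≤ n, ∑ T ∈ Finset.powersetCard k Finset.univ, f T = n.choose k * p.eval (k : ℝ) := by
  refine Submodule.span_induction (p := fun f _ => ∃ p : Polynomial ℝ, p.degree ≤ d ∧
    p.eval 0 = 0 ∧ ∀ k ≤ n, ∑ T ∈ Finset.powersetCard k Finset.univ, f T =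
      n.choose k * p.eval (k : ℝ)) ?_ ⟨0, by simp, by simp, by simp⟩ ?_ ?_ hf
  · rintro _ ⟨S, ⟨hS, hSd⟩, rfl⟩
    have hsn : S.card ≤ n := by simpa using Finset.card_le_univ S
    have hpos : (n.choose S.card : ℝ) ≠ 0 := by
      exact_mod_cast (Nat.choose_pos hsn).ne'
    have hfac : (S.card.factorial : ℝ) ≠ 0 := by exact_mod_cast S.card.factorial_ne_zero
    have hev : ∀ k : ℕ, (descPochhammer ℝ S.card).eval (k : ℝ) =
        S.card.factorial * k.choose S.card := by
      intro k
      rw [descPochhammer_eval_eq_descFactorial, Nat.descFactorial_eq_factorial_mul_choose]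
      push_cast; ring
    -- With `s = |S|`, the proportion of `k`-sets that contain `S` is `choose k s / choose n s`.
    -- This is a falling factorial in `k`, of degree `s`, and it vanishes at 0 because `s > 0`.
    refine ⟨Polynomial.C (1 / (S.card.factorial * n.choose S.card : ℝ)) *
      descPochhammer ℝ S.card, ?_, ?_, ?_⟩
    · refine Polynomial.natDegree_le_iff_degree_le.1 ((Polynomial.natDegree_C_mul_le _ _).trans ?_)
      rwa [descPochhammer_natDegree]
    · have := hev 0
      rw [Nat.cast_zero] at this
      rw [Polynomial.eval_mul, this, Nat.choose_eq_zero_of_lt hS.card_pos]; simp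
    · intro k hk
      have hcount : ∑ T ∈ Finset.powersetCard k Finset.univ, containing S T =
          (((Finset.powersetCard k Finset.univ).filter (S ⊆ ·)).card : ℝ) := by
        simp [containing]
      rw [hcount, Polynomial.eval_mul, hev, Polynomial.eval_C]
      rcases le_or_gt S.card k with h | h
      · rw [card_powersetCard_filter_subset S h]
        have := Nat.choose_mul (n := n) h
        have : (n.choose k : ℝ) * k.choose S.card =
          n.choose S.card * (n - S.card).choose (k - S.card) := by exact_mod_cast this
        field_simp
        linarith
      · rw [Nat.choose_eq_zero_of_lt h, Finset.card_eq_zero.2]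
        · simp
        · refine Finset.filter_eq_empty_iff.2 fun T hT hST => ?_
          have := Finset.card_le_card hST
          rw [(Finset.mem_powersetCard.1 hT).2] at this
          omega
  · rintro f g _ _ ⟨p, hp, hp0, hpk⟩ ⟨r, hr, hr0, hrk⟩
    refine ⟨p + r, (Polynomial.degree_add_le _ _).trans (max_le hp hr), by simp [hp0, hr0], ?_⟩
    intro k hk
    simp only [Pi.add_apply, Finset.sum_add_distrib, hpk k hk, hrk k hk, Polynomial.eval_add]
    ring
  · rintro a f _ ⟨p, hp, hp0, hpk⟩
    refine ⟨a • p, (Polynomial.degree_smul_le _ _).trans hp, by simp [hp0], ?_⟩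
    intro k hk
    simp only [Pi.smul_apply, smul_eq_mul, ← Finset.mul_sum, hpk k hk, Polynomial.eval_smul]
    ring

/-! ### Best uniform approximation of the constant 1 -/

/-- `δ` is the distance from the constant `1` to the functions of degree at most `d`, uniformly on
the nonempty sets, and it is attained. -/
def IsBestDistance (n d : ℕ) (δ : ℝ) : Prop :=
  (∃ f ∈ lowDegree n d, ∀ T : Finset (Fin n), T.Nonempty → |f T - 1| ≤ δ) ∧
  ∀ f ∈ lowDegree n d, ∀ c : ℝ, (∀ T : Finset (Fin n), T.Nonempty → |f T - 1| ≤ c) → δ ≤ c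

/-- The restrictions to nonempty sets form a finite-dimensional, hence closed, subspace of a proper
space, so the distance in the sup metric is attained. -/
theorem exists_isBestDistance {n : ℕ} (hn : 2 ≤ n) (d : ℕ) :
    ∃ δ : ℝ, 0 ≤ δ ∧ IsBestDistance n d δ := by
  let res : (Finset (Fin n) → ℝ) →ₗ[ℝ] ({T : Finset (Fin n) // T.Nonempty} → ℝ) :=
    LinearMap.funLeft ℝ ℝ Subtype.val
  let V := (lowDegree n d).map res
  have hcl : IsClosed (V : Set ({T : Finset (Fin n) // T.Nonempty} → ℝ)) :=
    V.closed_of_finiteDimensional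
  obtain ⟨g, hg, hgd⟩ := hcl.exists_infDist_eq_dist ⟨0, V.zero_mem⟩ (fun _ => 1)
  obtain ⟨f, hf, rfl⟩ := Submodule.mem_map.1 hg
  have key : ∀ (f : Finset (Fin n) → ℝ) (c : ℝ), 0 ≤ c →
      (dist (fun _ => 1) (res f) ≤ c ↔ ∀ T : Finset (Fin n), T.Nonempty → |f T - 1| ≤ c) := by
    intro f c hc
    rw [dist_pi_le_iff hc, Subtype.forall]
    refine forall₂_congr fun T hT => ?_
    rw [Real.dist_eq, abs_sub_comm]
    rfl
  refine ⟨Metric.infDist (fun _ => 1) (V : Set ({T : Finset (Fin n) // T.Nonempty} → ℝ)),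
    Metric.infDist_nonneg, ⟨f, hf, ?_⟩, ?_⟩
  · exact (key f _ Metric.infDist_nonneg).1 hgd.ge
  · intro f' hf' c hc
    have hc0 : 0 ≤ c :=
      (abs_nonneg _).trans (hc {⟨0, by omega⟩} (Finset.singleton_nonempty _))
    exact (Metric.infDist_le_dist_of_mem (Submodule.mem_map_of_mem hf')).trans
      ((key f' c hc0).2 hc)

/-- The best uniform distance is the Chebyshev bound exactly if the extremal points of the shifted
Chebyshev polynomial are integers. -/
theorem IsBestDistance.eq_chebyshevBound_iff {n d : ℕ} (hn : 2 ≤ n) (hd : 1 ≤ d) {δ : ℝ}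
    (hδ : IsBestDistance n d δ) :
    δ = chebyshevBound n d ↔ ∀ i ≤ d, ∃ k : ℤ, gridPoint n d i = k := by
  have poly_mem : ∀ p : Polynomial ℝ, p.degree ≤ d → p.eval 0 = 1 →
      (fun T : Finset (Fin n) => (1 - p).eval (T.card : ℝ)) ∈ lowDegree n d := by
    intro p hp hp0
    refine eval_card_mem_lowDegree ?_ (by simp [hp0])
    refine (Polynomial.degree_sub_le _ _).trans (max_le ?_ hp)
    exact Polynomial.degree_one_le.trans (by exact_mod_cast Nat.zero_le d)
  have card_bounds : ∀ T : Finset (Fin n), T.Nonempty → 1 ≤ T.card ∧ T.card ≤ n := fun T hT =>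
    ⟨hT.card_pos, by simpa using Finset.card_le_univ T⟩
  constructor
  · intro h
    by_contra hE
    obtain ⟨p, hp, hp0, hlt⟩ := exists_forall_abs_lt_chebyshevBound hn (by omega) hE
    have hne : (Finset.Icc 1 n).Nonempty := ⟨1, Finset.mem_Icc.2 ⟨le_rfl, by omega⟩⟩
    -- Finitely many strict bounds give a strict bound on the maximum, which contradicts the
    -- minimality of `δ`.
    obtain ⟨k, hk, hmax⟩ := Finset.exists_max_image _ (fun k : ℕ => |p.eval (k : ℝ)|) hne
    have := hδ.2 _ (poly_mem p hp hp0) (|p.eval (k : ℝ)|) (fun T hT => by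
      have := hmax T.card (Finset.mem_Icc.2 (card_bounds T hT))
      rw [Polynomial.eval_sub, Polynomial.eval_one, sub_sub_cancel_left, abs_neg]
      exact this)
    have hk' := Finset.mem_Icc.1 hk
    linarith [hlt k hk'.1 hk'.2]
  · intro hE
    apply le_antisymm
    · refine hδ.2 _ (poly_mem _ (chebyshevPoly_degree_le n d) (chebyshevPoly_eval_zero hn d)) _ ?_
      intro T hT
      rw [Polynomial.eval_sub, Polynomial.eval_one, sub_sub_cancel_left, abs_neg]
      have := card_bounds T hT
      exact abs_chebyshevPoly_eval_le hn d ⟨by exact_mod_cast this.1, by exact_mod_cast this.2⟩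
    · obtain ⟨f, hf, hfδ⟩ := hδ.1
      obtain ⟨p, hp, hp0, hpk⟩ := exists_polynomial_sum_powersetCard hf
      -- Symmetrization: averaging `f - 1` over all `k`-sets does not increase its distance from 0,
      -- and the averages are the values of a polynomial.
      refine chebyshevBound_le_of_forall_abs_le hn hE (p := 1 - p) ?_ (by simp [hp0]) ?_
      · refine (Polynomial.degree_sub_le _ _).trans (max_le ?_ hp)
        exact Polynomial.degree_one_le.trans (by exact_mod_cast Nat.zero_le d)
      · intro k hk hkn
        have hch : (0 : ℝ) < n.choose k := by exact_mod_cast Nat.choose_pos hkn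
        have hcard : ((Finset.powersetCard k (Finset.univ : Finset (Fin n))).card : ℝ) =
            n.choose k := by
          rw [Finset.card_powersetCard, Finset.card_univ, Fintype.card_fin]
        have hsum : ∑ T ∈ Finset.powersetCard k Finset.univ, (f T - 1) =
            -(n.choose k * (1 - p).eval (k : ℝ)) := by
          rw [Finset.sum_sub_distrib, hpk k hkn, Finset.sum_const, nsmul_eq_mul, hcard,
            Polynomial.eval_sub, Polynomial.eval_one]
          ring
        have hle : |∑ T ∈ Finset.powersetCard k Finset.univ, (f T - 1)| ≤ n.choose k * δ := by
          refine (Finset.abs_sum_le_sum_abs _ _).trans ?_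
          rw [← hcard, ← nsmul_eq_mul]
          refine Finset.sum_le_card_nsmul _ _ _ fun T hT => hfδ T ?_
          rw [← Finset.card_pos, (Finset.mem_powersetCard.1 hT).2]
          omega
        rw [hsum, abs_neg, abs_mul, abs_of_pos hch] at hle
        exact le_of_mul_le_mul_left hle hch

/-! ### Moments and conditional expectations of linear combinations -/

/-- The linear combination of the signals with the given coefficients. -/
def linComb {n : ℕ} (c : Finset (Fin n) → ℝ) (x : Signals n) : ℝ := ∑ T, c T * x T

variable {n : ℕ}

theorem target_eq_linComb : (target : Signals n → ℝ) = linComb 1 := by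
  funext x; simp [target, linComb]

theorem info_le (i : Fin n) :
    (info i : MeasurableSpace (Signals n)) ≤ (inferInstance : MeasurableSpace (Signals n)) := by
  refine Measurable.comap_le (measurable_pi_lambda _ fun T => ?_)
  exact measurable_pi_apply _

theorem measurable_linComb (c : Finset (Fin n) → ℝ) : Measurable (linComb c) := by
  unfold linComb; fun_prop

theorem memLp_signal (D : Prior n) (T : Finset (Fin n)) :
    MemLp (fun x : Signals n => x T) 2 D.joint :=
  (D.memLp T).comp_measurePreserving
    (measurePreserving_eval (fun T => (D.law T : Measure ℝ)) T)

theorem memLp_linComb (D : Prior n) (c : Finset (Fin n) → ℝ) : MemLp (linComb c) 2 D.joint := by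
  unfold linComb
  exact memLp_finsetSum _ fun T _ => (memLp_signal D T).const_mul (c T)

theorem integrable_signal (D : Prior n) (T : Finset (Fin n)) :
    Integrable (fun x : Signals n => x T) D.joint :=
  (memLp_signal D T).integrable (by norm_num)

theorem integrable_linComb (D : Prior n) (c : Finset (Fin n) → ℝ) :
    Integrable (linComb c) D.joint :=
  (memLp_linComb D c).integrable (by norm_num)

theorem integral_signal (D : Prior n) (T : Finset (Fin n)) :
    ∫ x : Signals n, x T ∂D.joint = 0 := by
  have h := (measurePreserving_eval (fun T => (D.law T : Measure ℝ)) T).map_eq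
  have h2 : ∫ y : ℝ, y ∂(Measure.map (Function.eval T) D.joint) = ∫ x, x T ∂D.joint :=
    integral_map (measurable_pi_apply T).aemeasurable aestronglyMeasurable_id
  rw [← h2, Prior.joint, h, D.mean_zero]

theorem integral_linComb (D : Prior n) (c : Finset (Fin n) → ℝ) :
    ∫ x, linComb c x ∂D.joint = 0 := by
  unfold linComb
  rw [integral_finsetSum _ fun T _ => (integrable_signal D T).const_mul (c T)]
  simp [integral_const_mul, integral_signal]

/-- The variance of a signal. -/
def Prior.signalVar (D : Prior n) (T : Finset (Fin n)) : ℝ :=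
  variance (fun x : ℝ => x) (D.law T : Measure ℝ)

theorem Prior.signalVar_nonneg (D : Prior n) (T : Finset (Fin n)) : 0 ≤ D.signalVar T :=
  variance_nonneg _ _

theorem Prior.signalVar_empty (D : Prior n) : D.signalVar ∅ = 0 := by
  rw [Prior.signalVar, D.law_empty, variance_dirac]

theorem variance_linComb (D : Prior n) (c : Finset (Fin n) → ℝ) :
    variance (linComb c) D.joint = ∑ T, c T ^ 2 * D.signalVar T := by
  have h := variance_sum_pi (μ := fun T => (D.law T : Measure ℝ))
    (X := fun T x => c T * x) (fun T => (D.memLp T).const_mul (c T))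
  have h2 : (∑ T, fun x : Signals n => c T * x T) = linComb c := by
    funext x; simp [linComb]
  rw [h2] at h
  rw [Prior.joint, h]
  exact Finset.sum_congr rfl fun T _ => variance_const_mul _ _ _

theorem evariance_linComb (D : Prior n) (c : Finset (Fin n) → ℝ) :
    evariance (linComb c) D.joint =
      ∑ T, ENNReal.ofReal (c T ^ 2) * ENNReal.ofReal (D.signalVar T) := by
  rw [← (memLp_linComb D c).ofReal_variance_eq, variance_linComb,
    ENNReal.ofReal_sum_of_nonneg fun T _ => mul_nonneg (sq_nonneg _) (D.signalVar_nonneg T)]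
  exact Finset.sum_congr rfl fun T _ => ENNReal.ofReal_mul (sq_nonneg _)

theorem evariance_target (D : Prior n) :
    evariance target D.joint = ∑ T, ENNReal.ofReal (D.signalVar T) := by
  rw [target_eq_linComb, evariance_linComb]
  simp

theorem lintegral_sq_linComb (D : Prior n) (c : Finset (Fin n) → ℝ) :
    ∫⁻ x, ENNReal.ofReal (linComb c x ^ 2) ∂D.joint =
      ∑ T, ENNReal.ofReal (c T ^ 2) * ENNReal.ofReal (D.signalVar T) := by
  rw [← evariance_linComb, evariance_eq_lintegral_ofReal, integral_linComb]
  simp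

/-- An observed signal is measurable for the expert. An unobserved one is independent of the whole
observation and has mean zero. -/
theorem condExp_signal (D : Prior n) (i : Fin n) (T : Finset (Fin n)) :
    D.joint[fun x : Signals n => x T | info i] =ᵐ[D.joint]
      fun x => if i ∈ T then x T else 0 := by
  by_cases hT : i ∈ T
  · simp only [hT, if_true]
    rw [condExp_of_stronglyMeasurable (info_le i) _ (integrable_signal D T)]
    have h1 : Measurable[info i] (observed i) := comap_measurable _
    exact ((measurable_pi_apply (⟨T, hT⟩ : {T : Finset (Fin n) // i ∈ T})).comp
      h1).stronglyMeasurable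
  · simp only [hT, if_false]
    have hI : iIndepFun (fun T (x : Signals n) => x T) D.joint :=
      iIndepFun_pi (μ := fun T => (D.law T : Measure ℝ)) (X := fun _ x => x)
        fun _ => aemeasurable_id
    have hdis : Disjoint ({T} : Finset (Finset (Fin n))) (Finset.univ.filter (i ∈ ·)) := by
      simpa using hT
    have hφ : Measurable fun y : ({T} : Finset (Finset (Fin n))) → ℝ => y ⟨T, by simp⟩ := by
      fun_prop
    have hψ : Measurable fun (y : (Finset.univ.filter (i ∈ ·) : Finset (Finset (Fin n))) → ℝ)
        (S : {T : Finset (Fin n) // i ∈ T}) => y ⟨S.1, by simpa using S.2⟩ := by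
      fun_prop
    have hI2 := (hI.indepFun_finset _ _ hdis fun T => measurable_pi_apply T).comp hφ hψ
    have hI3 : IndepFun (fun x : Signals n => x T) (observed i) D.joint := hI2
    have h := condExp_indep_eq (measurable_pi_apply T).comap_le (info_le i)
      (comap_measurable (fun x : Signals n => x T)).stronglyMeasurable hI3
    rw [integral_signal] at h
    exact h

theorem condExp_linComb (D : Prior n) (i : Fin n) (c : Finset (Fin n) → ℝ) :
    D.joint[linComb c | info i] =ᵐ[D.joint] linComb fun T => if i ∈ T then c T else 0 := by
  have h1 : linComb c = ∑ T, c T • fun x : Signals n => x T := by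
    funext x; simp [linComb]
  rw [h1]
  refine (condExp_finsetSum (fun T _ => (integrable_signal D T).smul (c T)) _).trans ?_
  have h2 : ∀ᵐ x ∂D.joint, ∀ T : Finset (Fin n),
      (D.joint[c T • fun x : Signals n => x T | info i]) x = c T * if i ∈ T then x T else 0 := by
    refine ae_all_iff.2 fun T => ?_
    filter_upwards [condExp_smul (c T) (fun x : Signals n => x T) (info i) (μ := D.joint),
      condExp_signal D i T] with x hx hx2
    rw [hx, Pi.smul_apply, hx2, smul_eq_mul]
  filter_upwards [h2] with x hx
  rw [Finset.sum_apply, linComb]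
  refine Finset.sum_congr rfl fun T _ => ?_
  rw [hx]
  split_ifs <;> simp

/-! ### Priors made of random signs -/

/-- The law of a random sign multiplied by a real number. -/
def signLaw (a : ℝ) : Measure ℝ :=
  (2⁻¹ : ENNReal) • Measure.dirac a + (2⁻¹ : ENNReal) • Measure.dirac (-a)

instance (a : ℝ) : IsProbabilityMeasure (signLaw a) :=
  ⟨by simp [signLaw, ENNReal.inv_two_add_inv_two]⟩

theorem integral_signLaw (a : ℝ) (f : ℝ → ℝ) : ∫ x, f x ∂signLaw a = (f a + f (-a)) / 2 := by
  have hi : ∀ b, Integrable f (Measure.dirac b) := fun b =>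
    integrable_dirac (by simp [enorm_lt_top])
  rw [signLaw, integral_add_measure ((hi _).smul_measure (by simp))
    ((hi _).smul_measure (by simp)), integral_smul_measure, integral_smul_measure,
    integral_dirac, integral_dirac]
  simp; ring

theorem memLp_signLaw (a : ℝ) : MemLp (fun x : ℝ => x) 2 (signLaw a) := by
  have h : ∀ᵐ x ∂signLaw a, ‖x‖ ≤ |a| := by
    rw [signLaw, ae_add_measure_iff]
    constructor <;>
    · refine Measure.ae_smul_measure ?_ _
      rw [ae_dirac_iff (measurableSet_le measurable_norm measurable_const)]
      simp
  exact MemLp.of_bound aestronglyMeasurable_id _ h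

theorem variance_signLaw (a : ℝ) : variance (fun x : ℝ => x) (signLaw a) = a ^ 2 := by
  rw [variance_of_integral_eq_zero aemeasurable_id' (by rw [integral_signLaw]; ring),
    integral_signLaw]
  ring

theorem signLaw_singleton_pos (a : ℝ) : 0 < signLaw a {a} := by
  simp [signLaw]

theorem signLaw_neg (a : ℝ) : signLaw (-a) = signLaw a := by
  rw [signLaw, signLaw, neg_neg, add_comm]

/-- The prior whose signals are independent random signs multiplied by given numbers. -/
def signPrior (a : Finset (Fin n) → ℝ) (h0 : a ∅ = 0) (hne : ∃ T, a T ≠ 0) : Prior n where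
  law T := ⟨signLaw (a T), inferInstance⟩
  memLp T := memLp_signLaw _
  mean_zero T := by simp [integral_signLaw]
  law_empty := by
    simp [h0, signLaw, ← add_smul, ENNReal.inv_two_add_inv_two]
  exists_variance_pos := by
    obtain ⟨T, hT⟩ := hne
    refine ⟨T, ?_⟩
    have := variance_signLaw (a T)
    simp only [ProbabilityMeasure.coe_mk, this]
    positivity

theorem signalVar_signPrior (a : Finset (Fin n) → ℝ) (h0 : a ∅ = 0) (hne : ∃ T, a T ≠ 0)
    (T : Finset (Fin n)) : (signPrior a h0 hne).signalVar T = a T ^ 2 :=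
  variance_signLaw (a T)

theorem signPrior_singleton_pos (a : Finset (Fin n) → ℝ) (h0 : a ∅ = 0) (hne : ∃ T, a T ≠ 0) :
    0 < (signPrior a h0 hne).joint {a} := by
  rw [Prior.joint, Measure.pi_singleton]
  refine pos_iff_ne_zero.2 (Finset.prod_ne_zero_iff.2 fun T _ => ?_)
  exact (signLaw_singleton_pos (a T)).ne'

theorem signPrior_singleton_neg_pos (a : Finset (Fin n) → ℝ) (h0 : a ∅ = 0)
    (hne : ∃ T, a T ≠ 0) : 0 < (signPrior a h0 hne).joint {-a} := by
  rw [Prior.joint, Measure.pi_singleton]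
  refine pos_iff_ne_zero.2 (Finset.prod_ne_zero_iff.2 fun T _ => ?_)
  have h := signLaw_singleton_pos (-a T)
  rw [signLaw_neg] at h
  exact h.ne'

theorem signPrior_ae_eq_zero (a : Finset (Fin n) → ℝ) (h0 : a ∅ = 0) (hne : ∃ T, a T ≠ 0) :
    ∀ᵐ x ∂(signPrior a h0 hne).joint, ∀ T, a T = 0 → x T = 0 := by
  refine ae_all_iff.2 fun T => ?_
  by_cases hT : a T = 0
  · have hv : ∀ᵐ y ∂((signPrior a h0 hne).law T : Measure ℝ), y = 0 := by
      change ∀ᵐ y ∂signLaw (a T), y = 0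
      rw [hT, signLaw, neg_zero, ae_add_measure_iff, and_self]
      exact Measure.ae_smul_measure ((ae_dirac_iff (measurableSet_singleton 0)).2 rfl) _
    filter_upwards [(measurePreserving_eval (fun T => ((signPrior a h0 hne).law T : Measure ℝ))
      T).quasiMeasurePreserving.ae hv] with x hx _
    exact hx
  · simp [hT]

/-- Lets almost sure identities be evaluated at the atoms of a prior of random signs. -/
theorem _root_.MeasureTheory.of_ae_of_singleton_pos {α : Type*} [MeasurableSpace α] {μ : Measure α}
    {p : α → Prop} {x : α} (h : ∀ᵐ y ∂μ, p y) (hx : 0 < μ {x}) : p x := by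
  by_contra hp
  refine hx.ne' (measure_mono_null ?_ (ae_iff.1 h))
  simpa using hp

theorem _root_.MeasureTheory.eq_of_ae_eq_of_singleton_pos {α β : Type*} [MeasurableSpace α]
    {μ : Measure α} {f g : α → β} {x : α} (h : f =ᵐ[μ] g) (hx : 0 < μ {x}) : f x = g x :=
  of_ae_of_singleton_pos (p := fun y => f y = g y) h hx

/-! ### Elicitability bounds the degree -/

/-- If a centred linear query is elicitable with respect to linear combinations of the signals,
then it vanishes wherever all of them do, for signals that the expert observes. -/
theorem Elicitable.linComb_eq_zero {Q : Query n} {J : Type} [Countable J]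
    {R : Prior n → J → Signals n → ℝ} (h : Elicitable Q R) {cQ : Finset (Fin n) → ℝ}
    {c : J → Finset (Fin n) → ℝ} (hQ : ∀ D, Q.val D =ᵐ[D.joint] linComb cQ)
    (hR : ∀ D j, R D j =ᵐ[D.joint] linComb (c j)) {a : Signals n}
    (ha : ∀ T, Q.agent ∉ T → a T = 0) (hc : ∀ j, linComb (c j) a = 0) : linComb cQ a = 0 := by
  obtain ⟨π, -, hπ⟩ := h
  by_cases hne : ∃ T, a T ≠ 0
  swap
  · push Not at hne
    simp [linComb, hne]
  have h0 : a ∅ = 0 := ha ∅ (by simp)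
  set D := signPrior a h0 hne
  -- Under `D` the unobserved signals vanish almost surely, so at an atom the expert knows the
  -- entire realization.
  have hkernel : ∀ x : Signals n, 0 < D.joint {x} → (∀ T, Q.agent ∉ T → x T = 0) →
      ∀ᵐ y ∂condExpKernel D.joint (info Q.agent) x, y = x := by
    intro x hx hx0
    set A : Set (Signals n) := observed Q.agent ⁻¹' {observed Q.agent x}
    have hAm : MeasurableSet[info Q.agent] A := ⟨_, measurableSet_singleton _, rfl⟩
    have hA : MeasurableSet A := info_le _ _ hAm
    -- The event `A` is decided by the expert's information, so its conditional probability is its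
    -- indicator, which is 1 at `x`.
    have h1 : (condExpKernel D.joint (info Q.agent) x).real A = 1 := by
      have hce := condExpKernel_ae_eq_condExp (μ := D.joint) (info_le Q.agent) hA
      have h2 := eq_of_ae_eq_of_singleton_pos hce hx
      have hsm : StronglyMeasurable[info Q.agent] (A.indicator fun _ : Signals n => (1 : ℝ)) :=
        stronglyMeasurable_const.indicator hAm
      rw [condExp_of_stronglyMeasurable (info_le Q.agent) hsm
        ((integrable_const 1).indicator hA)] at h2
      refine h2.trans ?_
      exact Set.indicator_of_mem (show x ∈ A from rfl) fun _ => (1 : ℝ)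
    have h3 : ∀ᵐ y ∂condExpKernel D.joint (info Q.agent) x, y ∈ A := by
      refine (mem_ae_iff_prob_eq_one hA).2 ?_
      rw [measureReal_def] at h1
      exact (ENNReal.toReal_eq_one_iff _).1 h1
    have h4 : ∀ᵐ y ∂condExpKernel D.joint (info Q.agent) x, ∀ T, a T = 0 → y T = 0 := by
      have h5 := signPrior_ae_eq_zero a h0 hne
      rw [← condExpKernel_comp_trim (μ := (signPrior a h0 hne).joint) (info_le Q.agent)] at h5
      have h6 := ae_of_ae_trim (info_le Q.agent) (Measure.ae_ae_of_ae_comp h5)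
      exact of_ae_of_singleton_pos
        (p := fun ω => ∀ᵐ y ∂condExpKernel D.joint (info Q.agent) ω, ∀ T, a T = 0 → y T = 0) h6 hx
    filter_upwards [h3, h4] with y hy hy0
    funext T
    by_cases hT : Q.agent ∈ T
    · exact congrFun (Set.mem_singleton_iff.1 hy) (⟨T, hT⟩ : {T : Finset (Fin n) // Q.agent ∈ T})
    · rw [hy0 T (ha T hT), hx0 T hT]
  have hmax : ∀ x : Signals n, 0 < D.joint {x} → (∀ T, Q.agent ∉ T → x T = 0) →
      (∀ j, linComb (c j) x = 0) →
      ∀ r, r ≠ linComb cQ x → π r (fun _ => 0) < π (linComb cQ x) fun _ => 0 := by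
    intro x hx hx0 hcx r hr
    have hk := hkernel x hx hx0
    have hRx : (fun j => R D j x) = fun _ => 0 :=
      funext fun j => (eq_of_ae_eq_of_singleton_pos (hR D j) hx).trans (hcx j)
    have hQx : Q.val D x = linComb cQ x := eq_of_ae_eq_of_singleton_pos (hQ D) hx
    have hint : ∀ s, ∫ y, π s (fun j => R D j y) ∂condExpKernel D.joint (info Q.agent) x =
        π s fun _ => 0 := by
      intro s
      rw [integral_congr_ae (g := fun _ => π s fun _ => 0), integral_const]
      · simp
      · filter_upwards [hk] with y hy
        rw [hy, hRx]
    have h6 := (of_ae_of_singleton_pos (hπ D) hx).2 r (by rwa [hQx])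
    rwa [hint, hint, hQx] at h6
  have hneg : ∀ c : Finset (Fin n) → ℝ, linComb c (-a) = -linComb c a := by
    intro c; simp [linComb]
  have hpos := hmax a (signPrior_singleton_pos a h0 hne) ha hc
  have hmin := hmax (-a) (signPrior_singleton_neg_pos a h0 hne)
    (fun T hT => by rw [Pi.neg_apply, ha T hT, neg_zero])
    (fun j => by rw [hneg, hc j, neg_zero])
  rw [hneg] at hmin
  by_contra hcon
  -- All references are 0 at both `a` and `-a`, so two distinct reports would each strictly beat the
  -- other under the payment `π · 0`.
  have hd : linComb cQ a ≠ -linComb cQ a := fun h => hcon (by linarith)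
  exact lt_asymm (hpos _ hd.symm) (hmin _ hd)

/-- A linear query that is elicitable with respect to linear combinations of low degree has degree
larger by at most one. -/
theorem Elicitable.mem_lowDegree {Q : Query n} {J : Type} [Finite J]
    {R : Prior n → J → Signals n → ℝ} (h : Elicitable Q R) {cQ : Finset (Fin n) → ℝ}
    {c : J → Finset (Fin n) → ℝ} (hQ : ∀ D, Q.val D =ᵐ[D.joint] linComb cQ)
    (hR : ∀ D j, R D j =ᵐ[D.joint] linComb (c j)) (hcQ : ∀ T, Q.agent ∉ T → cQ T = 0) {l : ℕ}
    (hc : ∀ j, (fun T => if Q.agent ∈ T then c j T else 0) ∈ lowDegree n l) :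
    cQ ∈ lowDegree n l := by
  let form : (Finset (Fin n) → ℝ) → Module.Dual ℝ (Signals n) := fun b =>
    ∑ T, b T • LinearMap.proj T
  have hform : ∀ b a, form b a = linComb b a := by
    intro b a; simp [form, linComb]
  let coef : Module.Dual ℝ (Signals n) →ₗ[ℝ] (Finset (Fin n) → ℝ) :=
    LinearMap.pi fun T => Module.Dual.eval ℝ (Signals n) (Pi.single T 1)
  have hcoef : ∀ b, coef (form b) = b := by
    intro b; funext T
    simp [coef, hform, linComb, Pi.single_apply]
  have hrestrict : ∀ (b : Finset (Fin n) → ℝ) (a : Signals n),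
      linComb b (fun T => if Q.agent ∈ T then a T else 0) =
        linComb (fun T => if Q.agent ∈ T then b T else 0) a := by
    intro b a
    refine Finset.sum_congr rfl fun T _ => ?_
    by_cases hT : Q.agent ∈ T <;> simp [hT]
  have hcQ' : (fun T => if Q.agent ∈ T then cQ T else 0) = cQ := by
    funext T
    by_cases hT : Q.agent ∈ T <;> simp [hT, hcQ]
  -- Duality in finite dimension: a linear form that vanishes on the common kernel of finitely many
  -- forms is in their span. Truncating the point `a` amounts to truncating the coefficients, which
  -- makes the vanishing lemma applicable to arbitrary `a`.
  have hspan : form cQ ∈ Submodule.span ℝ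
      (Set.range fun j => form fun T => if Q.agent ∈ T then c j T else 0) := by
    refine mem_span_of_iInf_ker_le_ker fun a ha => ?_
    simp only [Submodule.mem_iInf, LinearMap.mem_ker, hform] at ha ⊢
    have := h.linComb_eq_zero hQ hR (a := fun T => if Q.agent ∈ T then a T else 0)
      (fun T hT => by simp [hT]) (fun j => by rw [hrestrict, ha j])
    rwa [hrestrict, hcQ'] at this
  have hle : Submodule.span ℝ
      (Set.range fun j => form fun T => if Q.agent ∈ T then c j T else 0) ≤
      (lowDegree n l).comap coef := by
    rw [Submodule.span_le]
    rintro _ ⟨j, rfl⟩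
    simpa only [SetLike.mem_coe, Submodule.mem_comap, hcoef] using hc j
  have := hle hspan
  rwa [Submodule.mem_comap, hcoef] at this

theorem DAGElicits.wellFounded {m : ℕ} {G : Digraph (Option (Fin m))} {Q : Fin m → Query n}
    (h : DAGElicits G Q) : WellFounded fun v w => G.Adj w v := by
  have : IsTrans (Option (Fin m)) fun v w => Relation.TransGen G.Adj w v :=
    ⟨fun _ _ _ hab hbc => hbc.trans hab⟩
  have : Std.Irrefl fun v w : Option (Fin m) => Relation.TransGen G.Adj w v :=
    ⟨fun v => h.acyclic v⟩
  have hwf := Finite.wellFounded_of_trans_of_irrefl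
    fun v w : Option (Fin m) => Relation.TransGen G.Adj w v
  exact Subrelation.wf (fun h => Relation.TransGen.single h) hwf

theorem DAGElicits.exists_walk {m : ℕ} {G : Digraph (Option (Fin m))} {Q : Fin m → Query n}
    (h : DAGElicits G Q) (v : Option (Fin m)) : ∃ l, HasWalk G v none l := by
  induction v using h.wellFounded.induction with
  | _ v ih =>
    by_cases hv : v = none
    · exact ⟨0, hv ▸ HasWalk.nil _⟩
    · have := mt (h.sink_iff v).1 hv
      push Not at this
      obtain ⟨w, hw⟩ := this
      obtain ⟨l, hl⟩ := ih w hw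
      exact ⟨l + 1, HasWalk.cons hw hl⟩

open Classical in
/-- The answers of a linear aggregation rule are linear combinations of the signals with
coefficients that do not depend on the prior. -/
theorem AggRule.IsLinear.exists_coeff {R : AggRule n} (h : R.IsLinear) :
    ∃ c : Option (Fin R.size) → Finset (Fin n) → ℝ, c none = 1 ∧
      (∀ D v, vertexVal R.query D v =ᵐ[D.joint] linComb (c v)) ∧
      ∀ k T, (R.query k).agent ∉ T → c (some k) T = 0 := by
  obtain ⟨⟨G, hG, α, hα⟩, -⟩ := h
  have key : ∀ v : Option (Fin R.size), ∃ c : Finset (Fin n) → ℝ,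
      (v = none → c = 1) ∧ (∀ D, vertexVal R.query D v =ᵐ[D.joint] linComb c) ∧
      ∀ k, v = some k → ∀ T, (R.query k).agent ∉ T → c T = 0 := by
    intro v
    induction v using hG.wellFounded.induction with
    | _ v ih =>
      cases v with
      | none =>
        refine ⟨1, fun _ => rfl, fun D => ?_, by simp⟩
        rw [vertexVal, target_eq_linComb]
      | some k =>
        choose! c _ hc2 _ using ih
        -- The recursion from the sink upwards involves only the constants `α` and truncations, so
        -- one coefficient vector serves all priors.
        refine ⟨fun T => if (R.query k).agent ∈ T then
          (∑ v with G.Adj (some k) v, α k v • c v) T else 0, by simp, fun D => ?_, ?_⟩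
        · refine (hα D k).trans ((condExp_congr_ae ?_).trans (condExp_linComb D _ _))
          have hall : ∀ᵐ x ∂D.joint, ∀ v, G.Adj (some k) v →
              vertexVal R.query D v x = linComb (c v) x := by
            refine ae_all_iff.2 fun v => ?_
            by_cases hv : G.Adj (some k) v
            · filter_upwards [hc2 v hv D] with x hx _ using hx
            · simp [hv]
          filter_upwards [hall] with x hx
          have : ∀ v ∈ Finset.univ.filter (G.Adj (some k)),
              α k v * vertexVal R.query D v x = ∑ T, α k v * (c v T * x T) := by
            intro v hv
            rw [hx v (Finset.mem_filter.1 hv).2, linComb, Finset.mul_sum]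
          rw [Finset.sum_congr rfl this, Finset.sum_comm]
          refine Finset.sum_congr rfl fun T _ => ?_
          simp [Finset.sum_mul, mul_assoc]
        · rintro k' hk T hT
          obtain rfl := Option.some.inj hk
          simp [hT]
  choose c h1 h2 h3 using key
  exact ⟨c, h1 none rfl, fun D v => h2 v D, fun k => h3 (some k) k rfl⟩

/-- The output of a linear aggregation rule of order complexity at most `d` is a linear combination
of the signals whose coefficients have degree at most `d`. -/
theorem AggRule.IsLinear.exists_output_eq {R : AggRule n} (h : R.IsLinear) {d : ℕ}
    (hd : orderComplexity R.query ≤ d) :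
    ∃ f ∈ lowDegree n d, ∀ D, R.output D =ᵐ[D.joint] linComb f := by
  obtain ⟨c, hc1, hc2, hc3⟩ := h.exists_coeff
  obtain ⟨-, β, hβ⟩ := h
  -- If every eliciting graph exceeded `d`, each would reach `d + 1`, and so would the infimum.
  obtain ⟨G, hG, hGd⟩ : ∃ G, DAGElicits G R.query ∧ ∀ k, order G k ≤ d := by
    by_contra hcon
    push Not at hcon
    have : ((d : ℕ∞) + 1) ≤ orderComplexity R.query := by
      refine le_iInf₂ fun G hG => ?_
      obtain ⟨k, hk⟩ := hcon G hG
      exact (Order.add_one_le_of_lt hk).trans (le_iSup (fun k => order G k) k)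
    have h2 := this.trans hd
    norm_cast at h2
    omega
  -- `G` need not be the graph with the constants `α`, so this induction uses only elicitability
  -- along `G`. Length 0 is impossible, since a query is not a sink and therefore starts a walk of
  -- positive length to the target.
  have hmem : ∀ (l : ℕ) (k : Fin R.size), (∀ l', HasWalk G (some k) none l' → l' ≤ l) →
      c (some k) ∈ lowDegree n l := by
    intro l
    induction l with
    | zero =>
      intro k hk
      have hns := mt (hG.sink_iff (some k)).1 (by simp)
      push Not at hns
      obtain ⟨w, hw⟩ := hns
      obtain ⟨l, hl⟩ := hG.exists_walk w
      have := hk _ (HasWalk.cons hw hl)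
      omega
    | succ l ih =>
      intro k hk
      refine (hG.elicitable k).mem_lowDegree (c := fun v => c v.1)
        (fun D => hc2 D (some k)) (fun D v => hc2 D v.1) (hc3 k) ?_
      rintro ⟨v, hv⟩
      cases v with
      | none =>
        simp only [hc1]
        convert containing_mem_lowDegree (d := l + 1)
          (Finset.singleton_nonempty (R.query k).agent) (by simp) using 1
        funext T
        simp [containing]
      | some k' =>
        refine mem_mul_mem_lowDegree _ (ih k' fun l' hl' => ?_)
        have := hk _ (HasWalk.cons hv hl')
        omega
  refine ⟨∑ k, β k • c (some k), Submodule.sum_mem _ fun k _ =>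
    Submodule.smul_mem _ _ (hmem d k fun l hl => ?_), fun D => ?_⟩
  · have h2 := (le_iSup₂ (f := fun l (_ : HasWalk G (some k) none l) => (l : ℕ∞)) l hl).trans
      (hGd k)
    exact_mod_cast h2
  · have hall : ∀ᵐ x ∂D.joint, ∀ k, (R.query k).val D x = linComb (c (some k)) x :=
      ae_all_iff.2 fun k => hc2 D (some k)
    filter_upwards [hall] with x hx
    rw [AggRule.output, hβ]
    simp only [hx, linComb, Finset.mul_sum]
    rw [Finset.sum_comm]
    refine Finset.sum_congr rfl fun T _ => ?_
    simp [Finset.sum_mul, mul_assoc]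

/-! ### Superset queries realize every function of low degree -/

/-- The query that asks the smallest member of `S` for the sum of the signals `X_T`, `S ⊆ T`. -/
def supersetQuery (S : Finset (Fin n)) (hS : S.Nonempty) : Query n where
  agent := S.min' hS
  answer _ y := ∑ T, if h : S.min' hS ∈ T then containing S T * y ⟨T, h⟩ else 0
  measurable_answer _ := by
    refine Finset.measurable_fun_sum _ fun T _ => ?_
    by_cases h : S.min' hS ∈ T
    · simp only [h, dite_true]; fun_prop
    · simp only [h, dite_false]; fun_prop

theorem supersetQuery_val (S : Finset (Fin n)) (hS : S.Nonempty) (D : Prior n) :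
    (supersetQuery S hS).val D = linComb (containing S) := by
  funext x
  simp only [Query.val, supersetQuery, linComb, observed]
  refine Finset.sum_congr rfl fun T _ => ?_
  by_cases h : S.min' hS ∈ T
  · simp only [h, dite_true]
  · have : ¬S ⊆ T := fun hST => h (hST (S.min'_mem hS))
    simp [containing, h, this]

/-- A conditional expectation of a single random variable is elicitable by a quadratic payment. -/
theorem elicitable_of_ae_eq_condExp {Q : Query n} {J : Type} {R : Prior n → J → Signals n → ℝ}
    (j : J) (hR : ∀ D, Integrable (R D j) D.joint)
    (hQ : ∀ D, Q.val D =ᵐ[D.joint] D.joint[R D j | info Q.agent]) : Elicitable Q R := by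
  refine ⟨fun r y => 2 * r * y j - r ^ 2, fun r => by fun_prop, fun D => ?_⟩
  filter_upwards [(hR D).condExpKernel_ae (m := info Q.agent), hQ D,
    condExp_ae_eq_integral_condExpKernel (info_le Q.agent) (hR D)] with x hint hx hx'
  have hval : ∀ r : ℝ, ∫ y, 2 * r * R D j y - r ^ 2 ∂condExpKernel D.joint (info Q.agent) x =
      2 * r * Q.val D x - r ^ 2 := by
    intro r
    rw [integral_sub (hint.const_mul _) (integrable_const _), integral_const_mul, ← hx', ← hx]
    simp
  refine ⟨fun r => (hint.const_mul _).sub (integrable_const _), fun r hr => ?_⟩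
  rw [hval, hval]
  have : 0 < (r - Q.val D x) ^ 2 := by
    have := sub_ne_zero.2 hr
    positivity
  nlinarith

section Construction

variable (n) (d : ℕ)

/-- The nonempty sets of at most `d` experts. -/
abbrev SmallSet : Type := {S : Finset (Fin n) // S.Nonempty ∧ S.card ≤ d}

/-- An enumeration of the nonempty sets of at most `d` experts. -/
def smallSet (k : Fin (Fintype.card (SmallSet n d))) : SmallSet n d :=
  (Fintype.equivFin (SmallSet n d)).symm k

/-- One superset query for every nonempty set of at most `d` experts. -/
def supersetQueries (k : Fin (Fintype.card (SmallSet n d))) : Query n :=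
  supersetQuery (smallSet n d k).1 (smallSet n d k).2.1

/-- The set of experts that belongs to a vertex; it is empty for the target. -/
def vertexSet : Option (Fin (Fintype.card (SmallSet n d))) → Finset (Fin n)
  | none => ∅
  | some k => (smallSet n d k).1

/-- The graph in which the query of `S` refers to that of `S` without its smallest member. -/
def supersetGraph : Digraph (Option (Fin (Fintype.card (SmallSet n d)))) where
  Adj v w := ∃ k, v = some k ∧
    vertexSet n d w = (smallSet n d k).1.erase ((smallSet n d k).1.min' (smallSet n d k).2.1)

variable {n d}

theorem vertexSet_injective : Function.Injective (vertexSet n d) := by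
  have hne : ∀ k, (smallSet n d k).1 ≠ ∅ := fun k => (smallSet n d k).2.1.ne_empty
  rintro (_ | k) (_ | l) h
  · rfl
  · exact absurd h.symm (hne l)
  · exact absurd h (hne k)
  · rw [(Fintype.equivFin (SmallSet n d)).symm.injective (Subtype.ext h)]

/-- The target fits the pattern as the superset sum of `∅`, because every set contains `∅`. -/
theorem vertexVal_supersetQueries (D : Prior n) (v : Option (Fin (Fintype.card (SmallSet n d)))) :
    vertexVal (supersetQueries n d) D v = linComb (containing (vertexSet n d v)) := by
  cases v with
  | none =>
    rw [vertexVal, target_eq_linComb]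
    congr 1
  | some k => exact supersetQuery_val _ _ D

/-- The strict decrease gives acyclicity and bounds walk lengths by `|S| ≤ d`. Inclusion confines
the relevant experts to the members of `S`. -/
theorem card_lt_of_supersetGraph_adj {v w : Option (Fin (Fintype.card (SmallSet n d)))}
    (h : (supersetGraph n d).Adj v w) : vertexSet n d w ⊂ vertexSet n d v := by
  obtain ⟨k, rfl, hw⟩ := h
  rw [hw]
  exact Finset.erase_ssubset (Finset.min'_mem _ _)

theorem exists_supersetGraph_adj (k : Fin (Fintype.card (SmallSet n d))) :
    ∃ w, (supersetGraph n d).Adj (some k) w := by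
  set S := (smallSet n d k).1
  set S' := S.erase (S.min' (smallSet n d k).2.1) with hS'
  rcases S'.eq_empty_or_nonempty with h | h
  · exact ⟨none, k, rfl, h.symm⟩
  · have hc : S'.card ≤ d := (Finset.card_le_card (Finset.erase_subset _ _)).trans
      (smallSet n d k).2.2
    refine ⟨some (Fintype.equivFin (SmallSet n d) ⟨S', h, hc⟩), k, rfl, ?_⟩
    simp [vertexSet, smallSet, hS', S]

/-- With `i` the smallest member of `S`, `S ⊆ T` holds exactly if `i ∈ T` and `S \ {i} ⊆ T`. The
first condition is the truncation made by conditioning on expert `i`. -/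
theorem condExp_supersetGraph_adj {k : Fin (Fintype.card (SmallSet n d))}
    {w : Option (Fin (Fintype.card (SmallSet n d)))} (h : (supersetGraph n d).Adj (some k) w)
    (D : Prior n) : (supersetQueries n d k).val D =ᵐ[D.joint]
      D.joint[vertexVal (supersetQueries n d) D w | info (supersetQueries n d k).agent] := by
  obtain ⟨k', hk, hw⟩ := h
  obtain rfl := Option.some.inj hk
  rw [vertexVal_supersetQueries, hw]
  refine Filter.EventuallyEq.trans (Filter.EventuallyEq.of_eq ?_) (condExp_linComb D _ _).symm
  rw [supersetQueries, supersetQuery_val]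
  congr 1
  funext T
  set S := (smallSet n d k).1
  have hS : S.Nonempty := (smallSet n d k).2.1
  have : S ⊆ T ↔ S.min' hS ∈ T ∧ S.erase (S.min' hS) ⊆ T := by
    conv_lhs => rw [← Finset.insert_erase (S.min'_mem hS)]
    exact Finset.insert_subset_iff
  change (if S ⊆ T then (1 : ℝ) else 0) =
    if S.min' hS ∈ T then (if S.erase (S.min' hS) ⊆ T then 1 else 0) else 0
  simp only [this, ite_and]

theorem dagElicits_supersetGraph : DAGElicits (supersetGraph n d) (supersetQueries n d) where
  acyclic v hv := by
    have : ∀ w, Relation.TransGen (supersetGraph n d).Adj v w →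
        vertexSet n d w ⊂ vertexSet n d v := by
      intro w hw
      induction hw with
      | single h => exact card_lt_of_supersetGraph_adj h
      | tail _ h ih => exact (card_lt_of_supersetGraph_adj h).trans ih
    exact (this v hv).ne rfl
  sink_iff v := by
    constructor
    · intro h
      cases v with
      | none => rfl
      | some k =>
        obtain ⟨w, hw⟩ := exists_supersetGraph_adj k
        exact absurd hw (h w)
    · rintro rfl w ⟨k, hk, -⟩
      exact absurd hk (by simp)
  elicitable k := by
    obtain ⟨w, hw⟩ := exists_supersetGraph_adj k
    refine elicitable_of_ae_eq_condExp ⟨w, hw⟩ (fun D => ?_) (condExp_supersetGraph_adj hw)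
    rw [vertexVal_supersetQueries]
    exact integrable_linComb D _

theorem orderComplexity_supersetQueries_le : orderComplexity (supersetQueries n d) ≤ d := by
  refine iInf₂_le_of_le _ dagElicits_supersetGraph (iSup_le fun k => iSup₂_le fun l hl => ?_)
  have : ∀ v w l, HasWalk (supersetGraph n d) v w l →
      l + (vertexSet n d w).card ≤ (vertexSet n d v).card := by
    intro v w l h
    induction h with
    | nil => simp
    | cons h _ ih =>
      have := Finset.card_lt_card (card_lt_of_supersetGraph_adj h)
      omega
  have h1 := this _ _ _ hl
  have h2 : (vertexSet n d (some k)).card ≤ d := (smallSet n d k).2.2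
  exact_mod_cast (show l ≤ d by omega)

theorem agentComplexity_supersetQueries_le : agentComplexity (supersetQueries n d) ≤ d := by
  refine iInf₂_le_of_le _ dagElicits_supersetGraph (iSup_le fun k => ?_)
  have hsub : relevantAgents (supersetQueries n d) (supersetGraph n d) k ⊆
      ((smallSet n d k).1 : Set (Fin n)) := by
    rintro i ⟨j, hj, rfl⟩
    have : ∀ w, Relation.ReflTransGen (supersetGraph n d).Adj (some k) w →
        vertexSet n d w ⊆ vertexSet n d (some k) := by
      intro w hw
      induction hw with
      | refl => exact subset_rfl
      | tail _ h ih => exact (card_lt_of_supersetGraph_adj h).subset.trans ih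
    exact this _ hj (Finset.min'_mem _ (smallSet n d j).2.1)
  refine (Set.encard_le_encard hsub).trans ?_
  rw [Set.encard_coe_eq_coe_finsetCard]
  exact_mod_cast (smallSet n d k).2.2

/-- The rule that asks all superset queries and combines the answers linearly. -/
def supersetRule (b : Fin (Fintype.card (SmallSet n d)) → ℝ) : AggRule n where
  size := Fintype.card (SmallSet n d)
  query := supersetQueries n d
  agg a := ∑ k, b k * a k

theorem supersetRule_isLinear (b : Fin (Fintype.card (SmallSet n d)) → ℝ) :
    (supersetRule b).IsLinear := by
  classical
  refine ⟨⟨supersetGraph n d, dagElicits_supersetGraph, fun _ _ => 1, 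
    fun D (k : Fin (Fintype.card (SmallSet n d))) => ?_⟩, b, fun _ => rfl⟩
  obtain ⟨w, hw⟩ := exists_supersetGraph_adj k
  -- Each query has exactly one out-neighbour, so the constant coefficient 1 gives the required
  -- recursion.
  have hfilter : Finset.univ.filter ((supersetGraph n d).Adj (some k)) = {w} := by
    ext v
    simp only [Finset.mem_filter, Finset.mem_univ, true_and, Finset.mem_singleton]
    refine ⟨?_, fun h => h ▸ hw⟩
    rintro ⟨k', hk', hv⟩
    obtain ⟨k'', hk'', hw⟩ := hw
    obtain rfl := Option.some.inj hk'
    obtain rfl := Option.some.inj hk''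
    exact vertexSet_injective (hv.trans hw.symm)
  have hsum : (fun x => ∑ v with (supersetGraph n d).Adj (some k) v,
      (1 : ℝ) * vertexVal (supersetQueries n d) D v x) = vertexVal (supersetQueries n d) D w := by
    funext x
    rw [hfilter, Finset.sum_singleton, one_mul]
  have h := condExp_supersetGraph_adj hw D
  rw [← hsum] at h
  exact h

theorem exists_supersetRule_output {f : Finset (Fin n) → ℝ} (hf : f ∈ lowDegree n d) :
    ∃ b : Fin (Fintype.card (SmallSet n d)) → ℝ, ∀ D, (supersetRule b).output D = linComb f := by
  have hr : lowDegree n d = Submodule.span ℝ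
      (Set.range fun k : Fin (Fintype.card (SmallSet n d)) => containing (smallSet n d k).1) := by
    rw [lowDegree]
    congr 1
    ext g
    constructor
    · rintro ⟨S, hS, rfl⟩
      exact ⟨Fintype.equivFin (SmallSet n d) ⟨S, hS⟩, by simp [smallSet]⟩
    · rintro ⟨k, rfl⟩
      exact ⟨_, (smallSet n d k).2, rfl⟩
  rw [hr, Submodule.mem_span_range_iff_exists_fun] at hf
  obtain ⟨b, rfl⟩ := hf
  refine ⟨b, fun D => ?_⟩
  funext x
  have : ∀ k, (supersetQueries n d k).val D x = linComb (containing (smallSet n d k).1) x :=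
    fun k => congrFun (supersetQuery_val _ _ D) x
  change ∑ k, b k * (supersetQueries n d k).val D x = _
  simp only [this, linComb, Finset.mul_sum]
  rw [Finset.sum_comm]
  refine Finset.sum_congr rfl fun T _ => ?_
  simp [Finset.sum_mul, mul_assoc]

end Construction

/-! ### Loss and worst-case error of randomized linear rules -/

theorem Approximator.loss_eq_lintegral (A : Approximator n) (D : Prior n)
    {f : A.Context → Finset (Fin n) → ℝ}
    (hf : ∀ᵐ z ∂A.P, A.val D z =ᵐ[D.joint] linComb (f z)) :
    A.loss D = ∫⁻ z, ∑ T, ENNReal.ofReal ((f z T - 1) ^ 2) * ENNReal.ofReal (D.signalVar T)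
      ∂A.P := by
  have hm : AEMeasurable (fun p : A.Context × Signals n =>
      ENNReal.ofReal ((A.val D p.1 p.2 - target p.2) ^ 2)) (A.P.prod D.joint) := by
    have ht : Measurable (target : Signals n → ℝ) := by
      rw [target_eq_linComb]; exact measurable_linComb 1
    exact (((A.aemeasurable_val D).sub (ht.comp measurable_snd).aemeasurable).pow_const
      2).ennreal_ofReal
  rw [Approximator.loss, lintegral_prod _ hm]
  refine lintegral_congr_ae ?_
  filter_upwards [hf] with z hz
  have h := lintegral_sq_linComb D fun T => f z T - 1
  rw [← h]
  refine lintegral_congr_ae ?_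
  filter_upwards [hz] with x hx
  have : linComb (fun T => f z T - 1) x = linComb (f z) x - linComb 1 x := by
    simp [linComb, sub_mul]
  rw [hx, target_eq_linComb, this]

/-- The prior under which only the signal of `S` is random. -/
def singlePrior (S : Finset (Fin n)) (hS : S.Nonempty) : Prior n :=
  signPrior (Pi.single S 1) (by simp [hS.ne_empty.symm]) ⟨S, by simp⟩

theorem signalVar_singlePrior (S : Finset (Fin n)) (hS : S.Nonempty) (T : Finset (Fin n)) :
    (singlePrior S hS).signalVar T = if T = S then 1 else 0 := by
  rw [singlePrior, signalVar_signPrior, Pi.single_apply]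
  split_ifs <;> simp

/-- If the loss of an approximator is a weighted sum of the variances of the signals, then its
worst-case error is the largest weight, and it is attained. -/
theorem Approximator.exists_error_eq (hn : 2 ≤ n) (A : Approximator n)
    {e : Finset (Fin n) → ENNReal}
    (he : ∀ D, A.loss D = ∑ T, e T * ENNReal.ofReal (D.signalVar T)) :
    ∃ S : Finset (Fin n), S.Nonempty ∧ (∀ T, T.Nonempty → e T ≤ e S) ∧ A.error = e S ∧
      ∃ D, A.relLoss D = e S := by
  have hne : (Finset.univ.filter fun T : Finset (Fin n) => T.Nonempty).Nonempty :=
    ⟨{⟨0, by omega⟩}, by simp⟩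
  obtain ⟨S, hS, hmax⟩ := Finset.exists_max_image _ e hne
  have hS : S.Nonempty := by simpa using hS
  have hmax : ∀ T, T.Nonempty → e T ≤ e S := fun T hT => hmax T (by simpa using hT)
  -- The relative loss is an average of the weights `e T` by variances; `∅` has variance 0.
  -- `singlePrior` puts all variance on the maximizing set.
  have hle : ∀ D, A.relLoss D ≤ e S := by
    intro D
    refine ENNReal.div_le_of_le_mul ?_
    rw [he, evariance_target, Finset.mul_sum]
    refine Finset.sum_le_sum fun T _ => ?_
    rcases T.eq_empty_or_nonempty with rfl | hT
    · simp [D.signalVar_empty]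
    · gcongr
      exact hmax T hT
  have hD : A.relLoss (singlePrior S hS) = e S := by
    rw [Approximator.relLoss, he, evariance_target]
    simp [signalVar_singlePrior, apply_ite ENNReal.ofReal]
  exact ⟨S, hS, hmax, le_antisymm (iSup_le hle) (hD ▸ le_iSup A.relLoss _), _, hD⟩

/-- The structure of the approximators implemented by randomized linear aggregation rules. -/
theorem exists_coeff_of_mem_linApproximators {d : ℕ} {A : Approximator n}
    (hA : A ∈ linApproximators n d) : ∃ f : A.Context → Finset (Fin n) → ℝ,
      (∀ᵐ z ∂A.P, f z ∈ lowDegree n d) ∧ (∀ T, AEMeasurable (fun z => f z T) A.P) ∧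
      ∀ D, A.loss D = ∑ T, (∫⁻ z, ENNReal.ofReal ((f z T - 1) ^ 2) ∂A.P) *
        ENNReal.ofReal (D.signalVar T) := by
  obtain ⟨R, hR, hlin⟩ := hA
  have h1 : ∀ᵐ z ∂A.P, ∃ f : Finset (Fin n) → ℝ, f ∈ lowDegree n d ∧
      ∀ D, (R z).output D =ᵐ[D.joint] linComb f := by
    filter_upwards [hlin] with z hz
    exact hz.1.exists_output_eq hz.2.2
  obtain ⟨f, hf⟩ := Filter.skolem.1 h1
  have hval : ∀ D, ∀ᵐ z ∂A.P, A.val D z =ᵐ[D.joint] linComb (f z) := by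
    intro D
    filter_upwards [hf, Measure.ae_ae_of_ae_prod (hR D)] with z hz hz2
    exact Filter.EventuallyEq.trans hz2 (hz.2 D)
  -- The choice of `f` carries no measurability. It is recovered from the approximator itself: under
  -- `singlePrior T`, the value of `A` at the atom `Pi.single T 1` is `f z T`.
  have hmeas : ∀ T, AEMeasurable (fun z => f z T) A.P := by
    intro T
    rcases T.eq_empty_or_nonempty with rfl | hT
    · refine (aemeasurable_const (b := (0 : ℝ))).congr ?_
      filter_upwards [hf] with z hz
      exact (lowDegree_apply_empty hz.1).symm
    · set D := singlePrior T hT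
      have hpos : 0 < D.joint {(Pi.single T 1 : Signals n)} := signPrior_singleton_pos _ _ _
      have hmk := A.aemeasurable_val D
      refine ⟨fun z => hmk.mk _ (z, (Pi.single T 1 : Signals n)),
        hmk.measurable_mk.comp measurable_prodMk_right, ?_⟩
      filter_upwards [hval D, Measure.ae_ae_of_ae_prod hmk.ae_eq_mk] with z hz hz2
      have h2 := eq_of_ae_eq_of_singleton_pos hz hpos
      have h3 := of_ae_of_singleton_pos hz2 hpos
      rw [← h3, h2]
      simp [linComb, Pi.single_apply]
  refine ⟨f, hf.mono fun z hz => hz.1, hmeas, fun D => ?_⟩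
  have hm : ∀ T, AEMeasurable (fun z => ENNReal.ofReal ((f z T - 1) ^ 2)) A.P := fun T =>
    (((hmeas T).sub_const 1).pow_const 2).ennreal_ofReal
  rw [A.loss_eq_lintegral D (hval D), lintegral_finsetSum' _ fun T _ => (hm T).mul_const _]
  exact Finset.sum_congr rfl fun T _ => lintegral_mul_const'' _ (hm T)

theorem isGreatest_relLoss (hn : 2 ≤ n) {d : ℕ} {A : Approximator n}
    (hA : A ∈ linApproximators n d) : IsGreatest (Set.range A.relLoss) A.error := by
  obtain ⟨f, -, -, hloss⟩ := exists_coeff_of_mem_linApproximators hA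
  obtain ⟨S, -, -, herr, D, hD⟩ := A.exists_error_eq hn hloss
  exact ⟨⟨D, hD.trans herr.symm⟩, Set.forall_mem_range.2 (le_iSup A.relLoss)⟩

/-- **Jensen's inequality** for the square of the distance to `1`. -/
theorem sq_integral_sub_one_le {Ω : Type*} [MeasurableSpace Ω] {P : Measure Ω}
    [IsProbabilityMeasure P] {g : Ω → ℝ} (hg : AEMeasurable g P)
    (hfin : ∫⁻ z, ENNReal.ofReal ((g z - 1) ^ 2) ∂P ≠ ⊤) :
    Integrable g P ∧
      (∫ z, g z ∂P - 1) ^ 2 ≤ (∫⁻ z, ENNReal.ofReal ((g z - 1) ^ 2) ∂P).toReal := by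
  have hm : AEStronglyMeasurable (fun z => g z - 1) P := (hg.sub_const 1).aestronglyMeasurable
  have hnn : 0 ≤ᵐ[P] fun z => (g z - 1) ^ 2 := Filter.Eventually.of_forall fun _ => sq_nonneg _
  have hint : Integrable (fun z => (g z - 1) ^ 2) P :=
    ⟨hm.pow 2, (hasFiniteIntegral_iff_ofReal hnn).2 (lt_top_iff_ne_top.2 hfin)⟩
  have hLp : MemLp (fun z => g z - 1) 2 P := (memLp_two_iff_integrable_sq hm).2 hint
  have hgi : Integrable g P := by
    have := (hLp.integrable (by norm_num)).add (integrable_const (1 : ℝ))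
    refine this.congr (Filter.Eventually.of_forall fun z => ?_)
    simp
  refine ⟨hgi, ?_⟩
  have hv := variance_nonneg (fun z => g z - 1) P
  rw [variance_eq_sub hLp] at hv
  have h1 : ∫ z, g z - 1 ∂P = ∫ z, g z ∂P - 1 := by
    rw [integral_sub hgi (integrable_const _)]; simp
  rw [← integral_eq_lintegral_of_nonneg_ae hnn hint.1, ← h1]
  have h2 : ∫ z, (g z - 1) ^ 2 ∂P = P[(fun z => g z - 1) ^ 2] := rfl
  rw [h2]
  linarith

/-- The mean coefficient vector remains in the closed convex set `lowDegree`, and by Jensen its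
squared deviation from 1 is at most the mean squared deviation. An infinite error needs no argument.
-/
theorem IsBestDistance.le_error (hn : 2 ≤ n) {d : ℕ} {δ : ℝ} (hδ0 : 0 ≤ δ)
    (hδ : IsBestDistance n d δ) {A : Approximator n} (hA : A ∈ linApproximators n d) :
    ENNReal.ofReal (δ ^ 2) ≤ A.error := by
  obtain ⟨f, hf, hmeas, hloss⟩ := exists_coeff_of_mem_linApproximators hA
  obtain ⟨S, hS, hmax, herr, -⟩ := A.exists_error_eq hn hloss
  rw [herr]
  by_cases htop : ∫⁻ z, ENNReal.ofReal ((f z S - 1) ^ 2) ∂A.P = ⊤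
  · rw [htop]; exact le_top
  have hJ := fun (T : Finset (Fin n)) (hT : T.Nonempty) =>
    sq_integral_sub_one_le (hmeas T) (ne_top_of_le_ne_top htop (hmax T hT))
  have hint : Integrable f A.P := by
    refine Integrable.of_eval fun T => ?_
    rcases T.eq_empty_or_nonempty with rfl | hT
    · refine (integrable_zero _ ℝ A.P).congr ?_
      filter_upwards [hf] with z hz
      exact (lowDegree_apply_empty hz).symm
    · exact (hJ T hT).1
  have hmem : ∫ z, f z ∂A.P ∈ lowDegree n d :=
    (lowDegree n d).convex.integral_mem (lowDegree n d).closed_of_finiteDimensional hf hint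
  set c := (∫⁻ z, ENNReal.ofReal ((f z S - 1) ^ 2) ∂A.P).toReal
  have hle := hδ.2 _ hmem (√c) fun T hT => by
    refine Real.abs_le_sqrt ?_
    rw [eval_integral fun T => hint.eval T]
    exact (hJ T hT).2.trans (ENNReal.toReal_mono htop (hmax T hT))
  refine ENNReal.ofReal_le_of_le_toReal ?_
  calc δ ^ 2 ≤ √c ^ 2 := pow_le_pow_left₀ hδ0 hle 2
    _ = c := Real.sq_sqrt ENNReal.toReal_nonneg

/-! ### The optimal error and its value -/

/-- The deterministic approximator with the given coefficients. -/
def linApproximator (f : Finset (Fin n) → ℝ) : Approximator n where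
  Context := Unit
  P := Measure.dirac ()
  val _ _ := linComb f
  aemeasurable_val _ := ((measurable_linComb f).comp measurable_snd).aemeasurable

theorem linApproximator_mem {d : ℕ} {f : Finset (Fin n) → ℝ} (hf : f ∈ lowDegree n d) :
    linApproximator f ∈ linApproximators n d := by
  obtain ⟨b, hb⟩ := exists_supersetRule_output hf
  refine ⟨fun _ => supersetRule b, fun D => Filter.Eventually.of_forall fun p => ?_,
    Filter.Eventually.of_forall fun _ => ⟨supersetRule_isLinear b,
      agentComplexity_supersetQueries_le, orderComplexity_supersetQueries_le⟩⟩
  exact (congrFun (hb D) p.2).symm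

theorem linApproximator_loss (f : Finset (Fin n) → ℝ) (D : Prior n) :
    (linApproximator f).loss D =
      ∑ T, ENNReal.ofReal ((f T - 1) ^ 2) * ENNReal.ofReal (D.signalVar T) := by
  rw [(linApproximator f).loss_eq_lintegral D (f := fun _ => f)
    (Filter.Eventually.of_forall fun _ => Filter.EventuallyEq.rfl), lintegral_const,
    measure_univ, mul_one]

/-- The least worst-case error is the square of the best uniform distance. -/
theorem IsBestDistance.isLeast (hn : 2 ≤ n) {d : ℕ} {δ : ℝ} (hδ0 : 0 ≤ δ)
    (hδ : IsBestDistance n d δ) :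
    IsLeast (Approximator.error '' linApproximators n d) (ENNReal.ofReal (δ ^ 2)) := by
  obtain ⟨f, hf, hfδ⟩ := hδ.1
  have hmem := linApproximator_mem hf
  refine ⟨⟨linApproximator f, hmem, le_antisymm ?_ (hδ.le_error hn hδ0 hmem)⟩, ?_⟩
  · obtain ⟨S, hS, -, herr, -⟩ :=
      (linApproximator f).exists_error_eq hn (linApproximator_loss f)
    rw [herr]
    exact ENNReal.ofReal_le_ofReal (sq_le_sq.2 ((hfδ S hS).trans (le_abs_self δ)))
  · rintro _ ⟨A, hA, rfl⟩
    exact hδ.le_error hn hδ0 hA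

/-- A least element is unique, so the claim reduces to `δ ^ 2 = chebyshevBound n d ^ 2`, where both
bases are nonnegative. -/
theorem isLeast_error_iff {d : ℕ} (hn : 2 ≤ n) (hd : 1 ≤ d) :
    IsLeast (Approximator.error '' linApproximators n d)
        (ENNReal.ofReal (4 / (q n ^ (d : ℤ) + q n ^ (-(d : ℤ))) ^ 2)) ↔
      ∀ i ≤ d, ∃ k : ℤ, gridPoint n d i = k := by
  obtain ⟨δ, hδ0, hδ⟩ := exists_isBestDistance hn d
  have hleast := hδ.isLeast hn hδ0
  have hM := chebyshevBound_pos hn d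
  have hval : 4 / (q n ^ (d : ℤ) + q n ^ (-(d : ℤ))) ^ 2 = chebyshevBound n d ^ 2 := by
    rw [chebyshevBound_eq hn, div_pow]; norm_num
  rw [hval, ← hδ.eq_chebyshevBound_iff hn hd]
  constructor
  · intro h
    have h2 := (ENNReal.ofReal_eq_ofReal_iff (sq_nonneg _) (sq_nonneg _)).1 (hleast.unique h)
    exact (pow_left_inj₀ hδ0 hM.le two_ne_zero).1 h2
  · rintro rfl
    exact hleast

end PartialInfo

end

theorem mainTheorem6 (n d : ℕ) (hn : 2 ≤ n) (hd : 1 ≤ d) :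
    -- the maximum that defines the worst-case error of an approximator is attained,
    (∀ A ∈ PartialInfo.linApproximators n d, IsGreatest (Set.range A.relLoss) A.error) ∧
    -- and so is the minimum of the worst-case errors;
    (∃ e, IsLeast (PartialInfo.Approximator.error '' PartialInfo.linApproximators n d) e) ∧
    -- the minimum has the stated value exactly in the listed cases,
    (IsLeast (PartialInfo.Approximator.error '' PartialInfo.linApproximators n d)
        (ENNReal.ofReal
          (4 / (PartialInfo.q n ^ (d : ℤ) + PartialInfo.q n ^ (-(d : ℤ))) ^ 2)) ↔
      d = 1 ∨ (d = 2 ∧ Odd n) ∨ (d = 3 ∧ n ≡ 1 [MOD 4])) ∧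
    -- and exactly if the extremal points of the shifted Chebyshev polynomial are integers.
    (IsLeast (PartialInfo.Approximator.error '' PartialInfo.linApproximators n d)
        (ENNReal.ofReal
          (4 / (PartialInfo.q n ^ (d : ℤ) + PartialInfo.q n ^ (-(d : ℤ))) ^ 2)) ↔
      ∀ x ∈ Set.Icc (1 : ℝ) n,
        IsMaxOn (fun y => |PartialInfo.shiftedChebyshev n d y|) (Set.Icc (1 : ℝ) n) x →
          ∃ k : ℤ, x = k) := by
  obtain ⟨δ, hδ0, hδ⟩ := PartialInfo.exists_isBestDistance hn d
  refine ⟨fun A hA => PartialInfo.isGreatest_relLoss hn hA, ⟨_, hδ.isLeast hn hδ0⟩, ?_, ?_⟩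
  · rw [PartialInfo.isLeast_error_iff hn hd, PartialInfo.forall_gridPoint_isInt_iff hn hd]
  · rw [PartialInfo.isLeast_error_iff hn hd,
      PartialInfo.forall_isMaxOn_isInt_iff hn (by omega)]
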